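/- **Diamond root systems.** A Lie algebra over $\mathbb Z$ is an abelian group $\mathfrak G$ with a biadditive bracket satisfying $[x,x]=0$ and the Jacobi identity. Let $S$ be a finite base (finite $\mathbb Z$-basis) of $\mathfrak G$. Three different $\alpha,\beta,\gamma\in S$ are called *adjacent* if $\pm[\alpha,\beta],\pm[\beta,\gamma]\in S$, $[\alpha,\gamma]=0$, $[[\alpha,\beta],\gamma]=\pm[\alpha,[\beta,\gamma]]$ with $\pm[[\alpha,\beta],\gamma]\in S$, and $[\alpha,\beta]\neq\pm[\beta,\gamma]$. (Here $\pm x\in S$ means that $x\in S$ or $-x\in S$.) The base $S$ is a *diamond root system* if: 1) if $\alpha\in S$, then $-\alpha\notin S$; 2) for two different $\alpha,\beta\in S$, either $[\alpha,\beta]=0$ or $\pm[\alpha,\beta]\in S\setminus\{\alpha,\beta\}$; 3) three different $\alpha,\beta,\gamma\in S$ with $\pm[\alpha,\beta],\pm[\beta,\gamma]\in S$ and $[[\alpha,\beta],\gamma]\neq0$ are adjacent; 4) for four different $\xi,\eta,\sigma,\tau\in S$ with $[\xi,\eta]=[\sigma,\tau]\in S$, after a permutation of the letters that preserves the two pairs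 $\{\xi,\eta\}$, $\{\sigma,\tau\}$ or exchanges them, there are adjacent $\alpha,\beta,\gamma\in S$ with $\xi=\alpha$, $\eta=\pm[\beta,\gamma]$, $\sigma=\pm[\alpha,\beta]$, $\tau=\gamma$; and for every such permutation there are no adjacent $\alpha',\beta',\gamma'\in S$ with $\eta=\alpha'$, $\xi=\pm[\beta',\gamma']$ and either $\sigma=\pm[\alpha',\beta']$, $\tau=\gamma'$ or $\tau=\pm[\alpha',\beta']$, $\sigma=\gamma'$. **Theorem 2.2.** Let $L$ be a finite-dimensional simple complex Lie algebra, $H$ a Cartan subalgebra, $\alpha_1,\dots,\alpha_n$ a base of simple roots of the root system of $(L,H)$, and $x_i\neq0$ a root vector in the root space $L_{\alpha_i}$ for each $i$. Let $\mathfrak G\subset L$ be the Lie algebra over $\mathbb Z$ generated by $x_1,\dots,x_n$. Then $\mathfrak G$ has a base that consists of one root vector $e_\alpha\in L_\alpha$ for every positive root $\alpha$ and is a diamond root system (so that $\mathfrak G$ is a diamond Lie algebra), except when the Dynkin graph of $L$ is $C_n$ $(n>2)$ or $F_4$; in these exceptional cases $\mathfrak G$ has no such base. -/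

import Mathlib

/-- Equality up to sign. -/
def EqUpToSign {𝔊 : Type*} [LieRing 𝔊] (x y : 𝔊) : Prop :=
  x = y ∨ x = -y

/-- Membership up to sign: `±x ∈ S`. -/
def MemUpToSign {𝔊 : Type*} [LieRing 𝔊] (x : 𝔊) (S : Set 𝔊) : Prop :=
  x ∈ S ∨ -x ∈ S

/-- Three different elements `α, β, γ` of `S` are adjacent if `±[α,β], ±[β,γ] ∈ S`, `[α,γ] = 0`,
`[[α,β],γ] = ±[α,[β,γ]]`, this double bracket lies in `±S`, and `[α,β] ≠ ±[β,γ]`. -/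
structure IsAdjacent {𝔊 : Type*} [LieRing 𝔊] (S : Set 𝔊) (α β γ : 𝔊) : Prop where
  mem_left : α ∈ S
  mem_mid : β ∈ S
  mem_right : γ ∈ S
  ne_left : α ≠ β
  ne_right : β ≠ γ
  ne_outer : α ≠ γ
  lie_left : MemUpToSign ⁅α, β⁆ S
  lie_right : MemUpToSign ⁅β, γ⁆ S
  lie_outer : ⁅α, γ⁆ = 0
  assoc : EqUpToSign ⁅⁅α, β⁆, γ⁆ ⁅α, ⁅β, γ⁆⁆
  triple_left : MemUpToSign ⁅⁅α, β⁆, γ⁆ S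
  triple_right : MemUpToSign ⁅α, ⁅β, γ⁆⁆ S
  lie_ne : ¬ EqUpToSign ⁅α, β⁆ ⁅β, γ⁆

/-- The element `x` is the first member and `z` the last member of an adjacent triple
`α, β, γ` such that `x = α`, `y = ±[β,γ]`, `w = ±[α,β]`, `z = γ`. -/
def IsSplitBy {𝔊 : Type*} [LieRing 𝔊] (S : Set 𝔊) (x y w z : 𝔊) : Prop :=
  ∃ α β γ : 𝔊, IsAdjacent S α β γ ∧
    x = α ∧ EqUpToSign y ⁅β, γ⁆ ∧ EqUpToSign w ⁅α, β⁆ ∧ z = γ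

/-- A finite base `S` of a Lie algebra `𝔊` over `ℤ` (that is, of a Lie ring) is a diamond root
system if it satisfies the four axioms below. -/
structure IsDiamondRootSystem {𝔊 : Type*} [LieRing 𝔊] (S : Set 𝔊) : Prop where
  finite : S.Finite
  /-- `S` is a base of the abelian group `𝔊`: it is independent over `ℤ`, -/
  linearIndependent : LinearIndependent ℤ (fun s : S => (s : 𝔊))
  /-- and it generates the abelian group `𝔊`. -/
  span_eq_top : Submodule.span ℤ S = ⊤
  neg_notMem : ∀ α ∈ S, -α ∉ S
  lie_eq_zero_or_mem : ∀ α ∈ S, ∀ β ∈ S, α ≠ β →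
    ⁅α, β⁆ = 0 ∨ MemUpToSign ⁅α, β⁆ (S \ {α, β})
  /-- If `±[α,β], ±[β,γ] ∈ S` and `[[α,β],γ]` does not vanish, then `α, β, γ` are adjacent. -/
  adjacent : ∀ α ∈ S, ∀ β ∈ S, ∀ γ ∈ S, α ≠ β → β ≠ γ → α ≠ γ →
    MemUpToSign ⁅α, β⁆ S → MemUpToSign ⁅β, γ⁆ S → ⁅⁅α, β⁆, γ⁆ ≠ 0 → IsAdjacent S α β γ
  /-- Two disjoint pairs `{ξ, η}`, `{σ, τ}` with the same bracket come from an adjacent triple.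
  The equality of unordered pairs of unordered pairs says that `ξ', η', σ', τ'` is a permutation
  of `ξ, η, σ, τ` that respects the two pairs (it may exchange them). -/
  exists_split : ∀ ξ ∈ S, ∀ η ∈ S, ∀ σ ∈ S, ∀ τ ∈ S, [ξ, η, σ, τ].Nodup →
    ⁅ξ, η⁆ = ⁅σ, τ⁆ → ⁅ξ, η⁆ ∈ S →
    ∃ ξ' η' σ' τ' : 𝔊, s(s(ξ', η'), s(σ', τ')) = s(s(ξ, η), s(σ, τ)) ∧
      IsSplitBy S ξ' η' σ' τ'
  /-- They do so in one way only: when `ξ' = α`, `η' = ±[β,γ]`, `σ' = ±[α,β]`, `τ' = γ` for an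
  adjacent triple, the same two pairs do not arise from an adjacent triple `α', β', γ'` with
  `η' = α'` and `ξ' = ±[β',γ']`. -/
  split_unique : ∀ ξ ∈ S, ∀ η ∈ S, ∀ σ ∈ S, ∀ τ ∈ S, [ξ, η, σ, τ].Nodup →
    ⁅ξ, η⁆ = ⁅σ, τ⁆ → ⁅ξ, η⁆ ∈ S →
    ∀ ξ' η' σ' τ' : 𝔊, s(s(ξ', η'), s(σ', τ')) = s(s(ξ, η), s(σ, τ)) →
      IsSplitBy S ξ' η' σ' τ' →
      ¬ IsSplitBy S η' ξ' σ' τ' ∧ ¬ IsSplitBy S η' ξ' τ' σ'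

/-- The Lie algebra over `ℤ` generated, inside a complex Lie algebra, by given elements. -/
abbrev integralLieSpan {ι L : Type*} [LieRing L] (x : ι → L) : LieSubalgebra ℤ L :=
  LieSubalgebra.lieSpan ℤ L (Set.range x)

/-- Two Cartan matrices have the same Dynkin graph: they agree up to a bijection of the
index sets. -/
def SameDynkinGraph {ι κ : Type*} (A : Matrix ι ι ℤ) (B : Matrix κ κ ℤ) : Prop :=
  ∃ f : ι ≃ κ, ∀ i j : ι, A i j = B (f i) (f j)

/-!
A root vector of a positive root that is obtained from the `x i` by forming brackets is unique up
to sign, except in the cases `Cₙ` and `F₄`; these vectors are the required base.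

Normalize the squared lengths `ℓ` of the roots such that short roots have length `1`, and let
`r = 1, 2, 3` be the length of the long roots. Call the root system *tame* if, for `r = 2`,
nonproportional short roots are orthogonal, and if, for `r = 3`, they are not (`Diamond.IsTame`).
In a tame root system the lengths of the roots involved determine everything that is needed about
sums of roots:

* there are no three roots such that their pairwise sums and their total sum are roots
  (`Diamond.IsTame.no_triangle`);
* if `i + j = k + l` is a root, for four different positive roots, then exactly one of `i - k` and
  `i - l` is a root (`Diamond.IsTame.sub_mem_range_or_and_not_and`).

In characteristic zero the bracket of two root vectors does not vanish if the sum of the roots is a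
root (`Diamond.lie_ne_zero_of_mem_rootSpace`, by the theory of `sl₂`). So every positive root has an
iterated bracket of the `x i` as a root vector. If `⁅y, z⁆` and `⁅y', z'⁆` are two such brackets for
the weight `i + j = i' + j'`, and `i = i' + d`, say, then `j' = d + j`, and by induction on the
height, with a bracket `w` for `d`, they are `±⁅⁅y', w⁆, z⁆` and `±⁅y', ⁅w, z⁆⁆`. These agree by the
Jacobi identity, because `i' + j` is not a root (`Diamond.IsMonomial.eqUpToSign`). Hence one bracket
for each positive root gives a base that is closed under brackets up to sign, and the two facts
above translate into the axioms of a diamond root system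
(`Diamond.IsBracketClosed.isDiamondRootSystem`).

Every root system with `r ≠ 2` is tame. For `r = 2` the Weyl group reduces the question to simple
roots, modulo `2`: the root system is tame if no two short simple roots are joined in the Dynkin
diagram (`Diamond.IsNormalizedLength.isTame`). If two of them are joined, then the diagram is a
chain of type `Cₙ` or `F₄`, since any other diagram with a double edge contains an affine one, on
which the form is not positive (`Diamond.IsTwoLengthDiagram.sameDynkinGraph`).

In these two cases there is a chain of simple roots `i, j, k` with `i` long and `j`, `k` short. For
root vectors `a`, `d`, `c` of these roots the Jacobi identity gives
`⁅⁅⁅a, d⁆, d⁆, c⁆ = 2 ⁅⁅⁅a, d⁆, c⁆, d⁆`, but in a diamond root system both brackets would be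
the same root vector up to sign (`Diamond.not_isDiamondRootSystem`).
-/

/-! ### Normalized lengths of roots -/

namespace Diamond

open Set

section NormalizedLength

variable {ι K M N : Type*} [Fintype ι] [Field K] [CharZero K] [AddCommGroup M] [Module K M]
  [AddCommGroup N] [Module K N] {P : RootPairing ι K M N} [P.IsCrystallographic]

/-- `ℓ` is the squared length of the roots in units of the squared length of a short root, and `r`
is the squared length of a long root. If all roots have the same length, then `r = 1`. -/
structure IsNormalizedLength (P : RootPairing ι K M N) [P.IsCrystallographic]
    (ℓ : ι → ℤ) (r : ℤ) : Prop where
  ratio : r = 1 ∨ r = 2 ∨ r = 3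
  eq_or (i : ι) : ℓ i = 1 ∨ ℓ i = r
  exists_short : ∃ i, ℓ i = 1
  exists_long : ∃ i, ℓ i = r
  exists_scale : ∃ s : ℤ, 0 < s ∧ ∀ i, (P.posRootForm ℤ).rootLength i = s * ℓ i

/-- The invariant form on roots, normalized so that the form of a short root with itself is `2`. -/
noncomputable def inner (P : RootPairing ι K M N) [P.IsCrystallographic] (ℓ : ι → ℤ)
    (i j : ι) : ℤ :=
  P.pairingIn ℤ i j * ℓ j

theorem exists_isNormalizedLength [P.IsReduced] [P.IsIrreducible] [Nonempty ι] :
    ∃ ℓ r, IsNormalizedLength P ℓ r := by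
  have inj : Function.Injective (algebraMap ℤ K) := (algebraMap ℤ K).injective_int
  set L := (P.posRootForm ℤ).rootLength with hL
  have hpos : ∀ i, 0 < L i := fun i => (P.posRootForm ℤ).rootLength_pos i
  have hform : ∀ i, (P.posRootForm ℤ).toInvariantForm.form (P.root i) (P.root i) = (L i : K) := by
    intro i
    simpa using ((P.posRootForm ℤ).algebraMap_rootLength i).symm
  have hratio : ∀ i j, L i = L j ∨ L i = 2 * L j ∨ L i = 3 * L j ∨ L j = 2 * L i ∨
      L j = 3 * L i := by
    intro i j
    have := (P.posRootForm ℤ).toInvariantForm.apply_eq_or i j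
    simp only [hform] at this
    exact_mod_cast this
  obtain ⟨u, v, huv, hall⟩ : ∃ u v, L u ≤ L v ∧ ∀ k, L k = L u ∨ L k = L v := by
    obtain ⟨i, j, h⟩ := (P.posRootForm ℤ).toInvariantForm.exists_apply_eq_or
    simp only [hform, Int.cast_inj] at h
    rcases le_total (L i) (L j) with hij | hij
    · exact ⟨i, j, hij, h⟩
    · exact ⟨j, i, hij, fun k => (h k).symm⟩
  have hu := hpos u
  have hv := hpos v
  obtain ⟨r, hr, hr'⟩ : ∃ r : ℤ, (r = 1 ∨ r = 2 ∨ r = 3) ∧ L v = r * L u := by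
    rcases hratio v u with h | h | h | h | h
    · exact ⟨1, by simp, by simpa⟩
    · exact ⟨2, by simp, h⟩
    · exact ⟨3, by simp, h⟩
    all_goals omega
  refine ⟨fun k => if L k = L u then 1 else r, r, hr, fun i => ?_, ⟨u, by simp⟩, ⟨v, ?_⟩,
    L u, hu, fun i => ?_⟩
  · split_ifs <;> simp
  · split_ifs with h
    · rcases hr with rfl | rfl | rfl <;> omega
    · rfl
  · split_ifs with h
    · simpa using h
    · rw [mul_comm, ← hr']
      exact (hall i).resolve_left h

namespace IsNormalizedLength

variable {ℓ : ι → ℤ} {r : ℤ} (h : IsNormalizedLength P ℓ r)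
include h

lemma pos (i : ι) : 0 < ℓ i := by
  have := h.ratio
  rcases h.eq_or i with h | h <;> omega

lemma inner_comm (i j : ι) : inner P ℓ i j = inner P ℓ j i := by
  obtain ⟨s, hs, hs'⟩ := h.exists_scale
  have := (P.posRootForm ℤ).pairingIn_mul_eq_pairingIn_mul_swap i j
  rw [hs', hs', mul_left_comm, mul_left_comm _ s] at this
  exact (mul_left_cancel₀ hs.ne' this).symm

omit h [Fintype ι] in
lemma inner_self (i : ι) : inner P ℓ i i = 2 * ℓ i := by
  simp [inner]

omit h [Fintype ι] in
lemma inner_add_left {i j p : ι} (hp : P.root p = P.root i + P.root j) (k : ι) :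
    inner P ℓ p k = inner P ℓ i k + inner P ℓ j k := by
  have : P.pairingIn ℤ p k = P.pairingIn ℤ i k + P.pairingIn ℤ j k := by
    apply (algebraMap ℤ K).injective_int
    rw [map_add]
    simp only [P.algebraMap_pairingIn, ← P.root_coroot_eq_pairing, hp, map_add,
      LinearMap.add_apply]
  simp only [inner, this, add_mul]

lemma length_add {i j p : ι} (hp : P.root p = P.root i + P.root j) :
    ℓ p = ℓ i + ℓ j + inner P ℓ i j := by
  have h1 := inner_add_left (ℓ := ℓ) hp p
  have h2 := inner_add_left (ℓ := ℓ) hp i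
  have h3 := inner_add_left (ℓ := ℓ) hp j
  rw [h.inner_comm p i, h.inner_comm j i] at h2
  rw [h.inner_comm p j] at h3
  simp only [inner_self] at h1 h2 h3
  omega

lemma length_sub {i j p : ι} (hp : P.root p = P.root i - P.root j) :
    ℓ p = ℓ i + ℓ j - inner P ℓ i j := by
  have hp' : P.root i = P.root p + P.root j := by rw [hp]; abel
  have h1 := inner_add_left (ℓ := ℓ) hp' j
  have h2 := h.length_add hp'
  rw [inner_self] at h1
  omega

/-- The possible values of the normalized form on two nonproportional roots. -/
lemma inner_mem [P.IsReduced] {i j : ι} (hij : i ≠ j) (hij' : P.root i ≠ -P.root j) :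
    (ℓ i = 1 → ℓ j = 1 → inner P ℓ i j = -1 ∨ inner P ℓ i j = 0 ∨ inner P ℓ i j = 1) ∧
    (ℓ i = r ∨ ℓ j = r → inner P ℓ i j = -r ∨ inner P ℓ i j = 0 ∨ inner P ℓ i j = r) := by
  have h1 := P.pairingIn_pairingIn_mem_set_of_isCrystal_of_isRed' i j
    (fun e => hij (P.root.injective e)) hij'
  have h2 := h.inner_comm i j
  have h3 := h.ratio
  have h4 := h.eq_or i
  have h5 := h.eq_or j
  simp only [inner] at h2 ⊢
  simp only [Set.mem_insert_iff, Set.mem_singleton_iff, Prod.mk.injEq] at h1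
  generalize P.pairingIn ℤ i j = a at *
  generalize P.pairingIn ℤ j i = b at *
  generalize ℓ i = x at *
  generalize ℓ j = y at *
  rcases h3 with rfl | rfl | rfl <;> rcases h4 with rfl | rfl <;> rcases h5 with rfl | rfl <;> omega

lemma sub_mem_range_of_inner_pos {i j : ι} (hij : i ≠ j) (hpos : 0 < inner P ℓ i j) :
    P.root i - P.root j ∈ range P.root :=
  P.root_sub_root_mem_of_pairingIn_pos (pos_of_mul_pos_left hpos (h.pos j).le) hij

end IsNormalizedLength

end NormalizedLength

/-! ### Sums of roots when there are few short roots -/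

section Sums

variable {ι K M N : Type*} [Fintype ι] [Field K] [CharZero K] [AddCommGroup M] [Module K M]
  [AddCommGroup N] [Module K N] {P : RootPairing ι K M N} [P.IsCrystallographic]

/-- The condition on the short roots that singles out the root systems of types `A`, `B`, `D`, `E`
and `G₂` among the irreducible ones: nonproportional short roots are orthogonal if the long roots
have squared length `2`, and are not orthogonal if the long roots have squared length `3`. -/
structure IsTame (P : RootPairing ι K M N) [P.IsCrystallographic] (ℓ : ι → ℤ) (r : ℤ) : Prop
    extends IsNormalizedLength P ℓ r where
  inner_eq_zero : r = 2 → ∀ i j, i ≠ j → P.root i ≠ -P.root j → ℓ i = 1 → ℓ j = 1 →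
    inner P ℓ i j = 0
  inner_ne_zero : r = 3 → ∀ i j, i ≠ j → P.root i ≠ -P.root j → ℓ i = 1 → ℓ j = 1 →
    inner P ℓ i j ≠ 0

namespace IsTame

variable [P.IsReduced] {ℓ : ι → ℤ} {r : ℤ} (h : IsTame P ℓ r)
include h

/-- The values of the lengths of `i`, `j` and the form on them in a tame root system. -/
lemma length_inner_cases {i j : ι} (hij : i ≠ j) (hij' : P.root i ≠ -P.root j) :
    (r = 1 ∧ ℓ i = 1 ∧ ℓ j = 1 ∧ -1 ≤ inner P ℓ i j ∧ inner P ℓ i j ≤ 1) ∨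
    (r = 2 ∧ ((ℓ i = 1 ∧ ℓ j = 1 ∧ inner P ℓ i j = 0) ∨
      ((ℓ i = 2 ∧ ℓ j = 1 ∨ ℓ i = 1 ∧ ℓ j = 2 ∨ ℓ i = 2 ∧ ℓ j = 2) ∧
        (inner P ℓ i j = -2 ∨ inner P ℓ i j = 0 ∨ inner P ℓ i j = 2)))) ∨
    (r = 3 ∧ ((ℓ i = 1 ∧ ℓ j = 1 ∧ (inner P ℓ i j = 1 ∨ inner P ℓ i j = -1)) ∨
      ((ℓ i = 3 ∧ ℓ j = 1 ∨ ℓ i = 1 ∧ ℓ j = 3 ∨ ℓ i = 3 ∧ ℓ j = 3) ∧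
        (inner P ℓ i j = -3 ∨ inner P ℓ i j = 0 ∨ inner P ℓ i j = 3)))) := by
  have h1 := h.inner_mem hij hij'
  have h2 := h.eq_or i
  have h3 := h.eq_or j
  have h4 : r = 2 → ℓ i = 1 → ℓ j = 1 → inner P ℓ i j = 0 :=
    fun hr => h.inner_eq_zero hr i j hij hij'
  have h5 : r = 3 → ℓ i = 1 → ℓ j = 1 → inner P ℓ i j ≠ 0 :=
    fun hr => h.inner_ne_zero hr i j hij hij'
  rcases h.ratio with rfl | rfl | rfl <;> rcases h2 with h2 | h2 <;> rcases h3 with h3 | h3 <;>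
    simp [h2, h3] at h1 h4 h5 ⊢ <;> omega

/-- When the sum of two roots is a root, the form on them is determined by the three lengths. -/
lemma length_inner_cases_of_add {i j p : ι} (hp : P.root p = P.root i + P.root j) :
    (r = 1 ∧ ℓ i = 1 ∧ ℓ j = 1 ∧ ℓ p = 1 ∧ inner P ℓ i j = -1) ∨
    (r = 2 ∧ (ℓ i = 1 ∧ ℓ j = 1 ∧ ℓ p = 2 ∧ inner P ℓ i j = 0 ∨
      ℓ i = 2 ∧ ℓ j = 1 ∧ ℓ p = 1 ∧ inner P ℓ i j = -2 ∨
      ℓ i = 1 ∧ ℓ j = 2 ∧ ℓ p = 1 ∧ inner P ℓ i j = -2 ∨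
      ℓ i = 2 ∧ ℓ j = 2 ∧ ℓ p = 2 ∧ inner P ℓ i j = -2)) ∨
    (r = 3 ∧ (ℓ i = 1 ∧ ℓ j = 1 ∧ ℓ p = 1 ∧ inner P ℓ i j = -1 ∨
      ℓ i = 1 ∧ ℓ j = 1 ∧ ℓ p = 3 ∧ inner P ℓ i j = 1 ∨
      ℓ i = 3 ∧ ℓ j = 1 ∧ ℓ p = 1 ∧ inner P ℓ i j = -3 ∨
      ℓ i = 1 ∧ ℓ j = 3 ∧ ℓ p = 1 ∧ inner P ℓ i j = -3 ∨
      ℓ i = 3 ∧ ℓ j = 3 ∧ ℓ p = 3 ∧ inner P ℓ i j = -3)) := by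
  have hij : i ≠ j := by
    rintro rfl
    have h1 := h.length_add hp
    rw [IsNormalizedLength.inner_self] at h1
    have := h.ratio
    have := h.eq_or p
    have := h.eq_or i
    omega
  have hij' : P.root i ≠ -P.root j := by
    intro e
    exact P.ne_zero p (by rw [hp, e, neg_add_cancel])
  have h1 := h.length_inner_cases hij hij'
  have h2 := h.length_add hp
  have h3 := h.eq_or p
  rcases h1 with ⟨rfl, h1⟩ | ⟨rfl, h1 | ⟨h1 | h1 | h1, h4⟩⟩ | ⟨rfl, h1 | ⟨h1 | h1 | h1, h4⟩⟩ <;>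
    simp only [h1] at h2 ⊢ <;> rcases h3 with h3 | h3 <;> simp [h3] at h2 ⊢ <;> omega

/-- There are no three roots whose pairwise sums and whose total sum are roots. -/
lemma no_triangle {i j k p q s t : ι} (hp : P.root p = P.root i + P.root j)
    (hq : P.root q = P.root j + P.root k) (hs : P.root s = P.root i + P.root k)
    (ht : P.root t = P.root i + P.root j + P.root k) : False := by
  have h1 := h.length_inner_cases_of_add hp
  have h2 := h.length_inner_cases_of_add hq
  have h3 := h.length_inner_cases_of_add hs
  have ht' : P.root t = P.root p + P.root k := by rw [ht, hp]
  have h4 := h.length_add ht'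
  rw [IsNormalizedLength.inner_add_left hp] at h4
  rw [h.inner_comm j k, h.inner_comm i k] at *
  have h5 := h.pos t
  have h6 := h.eq_or t
  rcases h1 with ⟨rfl, h1⟩ | ⟨rfl, h1⟩ | ⟨rfl, h1⟩
  · omega
  · simp only [false_and, true_and, false_or, or_false, Int.reduceEq] at h2 h3
    omega
  · simp only [false_and, true_and, false_or, Int.reduceEq] at h2 h3
    omega

set_option maxHeartbeats 400000 in
/-- If a root is the sum of two roots in two ways, then exactly one of the two ways of taking
differences of summands gives a root. -/
lemma sub_mem_range_or_and_not_and {i j k l m : ι} (hm : P.root m = P.root i + P.root j)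
    (hm' : P.root m = P.root k + P.root l) (hik : i ≠ k) (hil : i ≠ l) (hjk : j ≠ k) (hjl : j ≠ l)
    (hik' : P.root i ≠ -P.root k) (hil' : P.root i ≠ -P.root l)
    (hjk' : P.root j ≠ -P.root k) (hjl' : P.root j ≠ -P.root l) :
    (P.root i - P.root k ∈ range P.root ∨ P.root i - P.root l ∈ range P.root) ∧
      ¬ (P.root i - P.root k ∈ range P.root ∧ P.root i - P.root l ∈ range P.root) := by
  have e1 : P.root j - P.root k = -(P.root i - P.root l) := by
    have := hm.symm.trans hm'
    rw [eq_sub_of_add_eq' this]; abel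
  have e2 : P.root j - P.root l = -(P.root i - P.root k) := by
    have := hm.symm.trans hm'
    rw [eq_sub_of_add_eq' this]; abel
  have a1 := h.length_inner_cases_of_add hm
  have a2 := h.length_inner_cases_of_add hm'
  have t1 := h.length_inner_cases hik hik'
  have t2 := h.length_inner_cases hil hil'
  have t3 := h.length_inner_cases hjk hjk'
  have t4 := h.length_inner_cases hjl hjl'
  have s1 := IsNormalizedLength.inner_add_left (ℓ := ℓ) hm k
  have s1' := IsNormalizedLength.inner_add_left (ℓ := ℓ) hm' k
  have s2 := IsNormalizedLength.inner_add_left (ℓ := ℓ) hm l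
  have s2' := IsNormalizedLength.inner_add_left (ℓ := ℓ) hm' l
  have s3 := IsNormalizedLength.inner_add_left (ℓ := ℓ) hm i
  have s3' := IsNormalizedLength.inner_add_left (ℓ := ℓ) hm' i
  have s4 := IsNormalizedLength.inner_add_left (ℓ := ℓ) hm j
  have s4' := IsNormalizedLength.inner_add_left (ℓ := ℓ) hm' j
  simp only [IsNormalizedLength.inner_self, h.inner_comm j i, h.inner_comm l k,
    h.inner_comm k i, h.inner_comm l i, h.inner_comm k j, h.inner_comm l j]
    at s1 s1' s2 s2' s3 s3' s4 s4'
  have p1 := h.sub_mem_range_of_inner_pos hik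
  have p2 := h.sub_mem_range_of_inner_pos hil
  have p3 := h.sub_mem_range_of_inner_pos hjk
  have p4 := h.sub_mem_range_of_inner_pos hjl
  rw [e1, P.neg_mem_range_root_iff] at p3
  rw [e2, P.neg_mem_range_root_iff] at p4
  have n1 : P.root i - P.root k ∈ range P.root →
      (ℓ i + ℓ k - inner P ℓ i k = 1 ∨ ℓ i + ℓ k - inner P ℓ i k = r) ∧
      (ℓ j + ℓ l - inner P ℓ j l = 1 ∨ ℓ j + ℓ l - inner P ℓ j l = r) := by
    intro hd
    have hd' := hd
    rw [← P.neg_mem_range_root_iff, ← e2] at hd'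
    obtain ⟨d, hd⟩ := hd
    obtain ⟨d', hd'⟩ := hd'
    rw [← h.length_sub hd, ← h.length_sub hd']
    exact ⟨h.eq_or d, h.eq_or d'⟩
  have n2 : P.root i - P.root l ∈ range P.root →
      (ℓ i + ℓ l - inner P ℓ i l = 1 ∨ ℓ i + ℓ l - inner P ℓ i l = r) ∧
      (ℓ j + ℓ k - inner P ℓ j k = 1 ∨ ℓ j + ℓ k - inner P ℓ j k = r) := by
    intro hd
    have hd' := hd
    rw [← P.neg_mem_range_root_iff, ← e1] at hd'
    obtain ⟨d, hd⟩ := hd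
    obtain ⟨d', hd'⟩ := hd'
    rw [← h.length_sub hd, ← h.length_sub hd']
    exact ⟨h.eq_or d, h.eq_or d'⟩
  -- In each case of lengths the form on one pair is positive, so that one difference is a root,
  -- while the other differences do not have the length of a root.
  have key : ((0 < inner P ℓ i k ∨ 0 < inner P ℓ j l) ∧
        ¬ ((ℓ i + ℓ l - inner P ℓ i l = 1 ∨ ℓ i + ℓ l - inner P ℓ i l = r) ∧
          (ℓ j + ℓ k - inner P ℓ j k = 1 ∨ ℓ j + ℓ k - inner P ℓ j k = r))) ∨
      ((0 < inner P ℓ i l ∨ 0 < inner P ℓ j k) ∧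
        ¬ ((ℓ i + ℓ k - inner P ℓ i k = 1 ∨ ℓ i + ℓ k - inner P ℓ i k = r) ∧
          (ℓ j + ℓ l - inner P ℓ j l = 1 ∨ ℓ j + ℓ l - inner P ℓ j l = r))) := by
    clear p1 p2 p3 p4 n1 n2 e1 e2 hm hm' hik hil hjk hjl hik' hil' hjk' hjl'
    clear h
    generalize inner P ℓ m k = mk at *
    generalize inner P ℓ m l = ml at *
    generalize inner P ℓ m i = mi at *
    generalize inner P ℓ m j = mj at *
    generalize inner P ℓ i j = ij at *
    generalize inner P ℓ k l = kl at *
    generalize inner P ℓ i k = ik at *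
    generalize inner P ℓ i l = il at *
    generalize inner P ℓ j k = jk at *
    generalize inner P ℓ j l = jl at *
    generalize ℓ i = i at *
    generalize ℓ j = j at *
    generalize ℓ k = k at *
    generalize ℓ l = l at *
    generalize ℓ m = m at *
    rcases a1 with ⟨rfl, a1⟩ | ⟨rfl, a1⟩ | ⟨rfl, a1⟩ <;>
      simp only [false_and, true_and, false_or, or_false, Int.reduceEq] at a2 t1 t2 t3 t4
    · omega
    · rcases a1 with ⟨rfl, rfl, rfl, rfl⟩ | ⟨rfl, rfl, rfl, rfl⟩ | ⟨rfl, rfl, rfl, rfl⟩ |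
        ⟨rfl, rfl, rfl, rfl⟩ <;>
      rcases a2 with ⟨rfl, rfl, h, rfl⟩ | ⟨rfl, rfl, h, rfl⟩ | ⟨rfl, rfl, h, rfl⟩ |
        ⟨rfl, rfl, h, rfl⟩ <;>
      norm_num at h <;> norm_num at t1 t2 t3 t4 <;> omega
    · rcases a1 with ⟨rfl, rfl, rfl, rfl⟩ | ⟨rfl, rfl, rfl, rfl⟩ | ⟨rfl, rfl, rfl, rfl⟩ |
        ⟨rfl, rfl, rfl, rfl⟩ | ⟨rfl, rfl, rfl, rfl⟩ <;>
      rcases a2 with ⟨rfl, rfl, h, rfl⟩ | ⟨rfl, rfl, h, rfl⟩ | ⟨rfl, rfl, h, rfl⟩ |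
        ⟨rfl, rfl, h, rfl⟩ | ⟨rfl, rfl, h, rfl⟩ <;>
      norm_num at h <;> norm_num at t1 t2 t3 t4 <;> omega
  rcases key with ⟨hp, hn⟩ | ⟨hp, hn⟩
  · exact ⟨.inl (hp.elim p1 p4), fun hAB => hn (n2 hAB.2)⟩
  · exact ⟨.inr (hp.elim p2 p3), fun hAB => hn (n1 hAB.1)⟩

end IsTame

end Sums

end Diamond

/-! ### Short roots and short simple roots -/

namespace Diamond

open Set

section ShortRoots

variable {ι K M N : Type*} [Fintype ι] [Field K] [CharZero K] [AddCommGroup M] [Module K M]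
  [AddCommGroup N] [Module K N] {P : RootPairing ι K M N} [P.IsCrystallographic]

namespace IsNormalizedLength

variable {ℓ : ι → ℤ} {r : ℤ} (h : IsNormalizedLength P ℓ r)

omit [Fintype ι] in
lemma inner_reflectionPerm_left (i j k : ι) :
    inner P ℓ (P.reflectionPerm k i) j = inner P ℓ i j - P.pairingIn ℤ i k * inner P ℓ k j := by
  have : P.pairingIn ℤ (P.reflectionPerm k i) j =
      P.pairingIn ℤ i j - P.pairingIn ℤ i k * P.pairingIn ℤ k j := by
    apply (algebraMap ℤ K).injective_int
    rw [map_sub, map_mul]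
    simp only [P.algebraMap_pairingIn, ← P.root_coroot_eq_pairing, P.root_reflectionPerm,
      P.reflection_apply_root, map_sub, map_smul, LinearMap.sub_apply, LinearMap.smul_apply,
      smul_eq_mul]
  simp only [inner, this]
  ring

include h

lemma length_reflectionPerm (i k : ι) : ℓ (P.reflectionPerm k i) = ℓ i := by
  have h1 := inner_reflectionPerm_left (P := P) (ℓ := ℓ) i (P.reflectionPerm k i) k
  have h2 := inner_reflectionPerm_left (P := P) (ℓ := ℓ) i i k
  have h3 := inner_reflectionPerm_left (P := P) (ℓ := ℓ) i k k
  have h4 : inner P ℓ i k = P.pairingIn ℤ i k * ℓ k := rfl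
  rw [h.inner_comm i, h.inner_comm k, h2, h3, h.inner_comm k i] at h1
  simp only [inner_self, h4] at h1
  linarith

variable (b : P.Base)

include b in
/-- Some simple root is long, since the roots are images of the simple ones under reflections,
which preserve lengths. -/
lemma exists_mem_support_long [Nonempty ι] [P.IsReduced] : ∃ i ∈ b.support, ℓ i = r := by
  by_contra! hne
  have hsimple : ∀ i ∈ b.support, ℓ i = 1 := fun i hi => (h.eq_or i).resolve_right (hne i hi)
  have hall : ∀ i, ℓ i = 1 := fun i =>
    b.induction_reflect i (fun i hi => by rw [h.length_reflectionPerm, hi]) hsimple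
      (fun i j hi _ => by rw [h.length_reflectionPerm, hi])
  obtain ⟨v, hv⟩ := h.exists_long
  obtain ⟨i, hi⟩ := b.support_nonempty
  exact hne i hi (by rw [hsimple i hi, ← hv, hall])

/-- If distinct short simple roots are orthogonal modulo `r`, then every short root is, modulo `r`
and up to sign, a short simple root as far as the form can see: the reflections in simple roots
preserve this property, because long roots are in the radical of the form modulo `r`. -/
lemma exists_short_simple_congruent [P.IsReduced]
    (hb : ∀ i ∈ b.support, ∀ j ∈ b.support, i ≠ j → ℓ i = 1 → ℓ j = 1 → r ∣ inner P ℓ i j)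
    (i : ι) (hi : ℓ i = 1) : ∃ p ∈ b.support, ℓ p = 1 ∧
      ((∀ j, r ∣ inner P ℓ i j - inner P ℓ p j) ∨ (∀ j, r ∣ inner P ℓ i j + inner P ℓ p j)) := by
  revert hi
  refine b.induction_reflect (p := fun i => ℓ i = 1 → ∃ p ∈ b.support, ℓ p = 1 ∧
    ((∀ j, r ∣ inner P ℓ i j - inner P ℓ p j) ∨ (∀ j, r ∣ inner P ℓ i j + inner P ℓ p j)))
    i ?_ ?_ ?_
  · intro i ih hi
    rw [h.length_reflectionPerm] at hi
    obtain ⟨p, hp, hp1, hp2⟩ := ih hi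
    refine ⟨p, hp, hp1, ?_⟩
    have e : ∀ j, inner P ℓ (P.reflectionPerm i i) j = -inner P ℓ i j := by
      intro j
      rw [inner_reflectionPerm_left, P.pairingIn_same]
      ring
    rcases hp2 with hp2 | hp2
    · right
      intro j
      obtain ⟨c, hc⟩ := hp2 j
      exact ⟨-c, by rw [e]; linear_combination -hc⟩
    · left
      intro j
      obtain ⟨c, hc⟩ := hp2 j
      exact ⟨-c, by rw [e]; linear_combination -hc⟩
  · exact fun i hi hi1 => ⟨i, hi, hi1, .inl fun j => by simp⟩
  · intro i k ih hk hi
    rw [h.length_reflectionPerm] at hi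
    obtain ⟨p, hp, hp1, hp2⟩ := ih hi
    refine ⟨p, hp, hp1, ?_⟩
    simp only [inner_reflectionPerm_left]
    by_cases hk1 : ℓ k = 1
    · have hik : P.pairingIn ℤ i k = inner P ℓ i k := by simp [inner, hk1]
      rw [hik]
      rcases eq_or_ne p k with rfl | hpk
      · have hself := inner_self (P := P) (ℓ := ℓ) p
        rw [hp1] at hself
        rcases hp2 with hp2 | hp2
        · right
          intro j
          obtain ⟨c, hc⟩ := hp2 j
          obtain ⟨d, hd⟩ := hp2 p
          refine ⟨c - d * inner P ℓ p j, ?_⟩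
          linear_combination hc - inner P ℓ p j * hd - inner P ℓ p j * hself
        · left
          intro j
          obtain ⟨c, hc⟩ := hp2 j
          obtain ⟨d, hd⟩ := hp2 p
          refine ⟨c - d * inner P ℓ p j, ?_⟩
          linear_combination hc - inner P ℓ p j * hd + inner P ℓ p j * hself
      · obtain ⟨m, hm⟩ : r ∣ inner P ℓ i k := by
          have h1 := hb p hp k hk hpk hp1 hk1
          rcases hp2 with hp2 | hp2
          · simpa using dvd_add (hp2 k) h1
          · simpa using dvd_sub (hp2 k) h1
        rw [hm]
        refine hp2.imp (fun hp2 j => ?_) (fun hp2 j => ?_)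
        · obtain ⟨c, hc⟩ := hp2 j
          exact ⟨c - m * inner P ℓ k j, by linear_combination hc⟩
        · obtain ⟨c, hc⟩ := hp2 j
          exact ⟨c - m * inner P ℓ k j, by linear_combination hc⟩
    · have hkr : ℓ k = r := (h.eq_or k).resolve_left hk1
      have hkj : ∀ j, inner P ℓ k j = P.pairingIn ℤ j k * r := by
        intro j
        rw [h.inner_comm, inner, hkr]
      simp only [hkj]
      refine hp2.imp (fun hp2 j => ?_) (fun hp2 j => ?_)
      · obtain ⟨c, hc⟩ := hp2 j
        exact ⟨c - P.pairingIn ℤ i k * P.pairingIn ℤ j k, by linear_combination hc⟩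
      · obtain ⟨c, hc⟩ := hp2 j
        exact ⟨c - P.pairingIn ℤ i k * P.pairingIn ℤ j k, by linear_combination hc⟩

lemma dvd_inner_of_short [P.IsReduced]
    (hb : ∀ i ∈ b.support, ∀ j ∈ b.support, i ≠ j → ℓ i = 1 → ℓ j = 1 → r ∣ inner P ℓ i j)
    {i j : ι} (hi : ℓ i = 1) (hj : ℓ j = 1) :
    ∃ p ∈ b.support, ∃ q ∈ b.support, ℓ p = 1 ∧ ℓ q = 1 ∧
      (r ∣ inner P ℓ i j - inner P ℓ p q ∨ r ∣ inner P ℓ i j + inner P ℓ p q) := by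
  obtain ⟨p, hp, hp1, hp2⟩ := h.exists_short_simple_congruent b hb i hi
  obtain ⟨q, hq, hq1, hq2⟩ := h.exists_short_simple_congruent b hb j hj
  refine ⟨p, hp, q, hq, hp1, hq1, ?_⟩
  rcases hp2 with hp2 | hp2 <;> rcases hq2 with hq2 | hq2 <;>
    obtain ⟨c, hc⟩ := hp2 j <;> obtain ⟨d, hd⟩ := hq2 p <;>
    rw [h.inner_comm j p, h.inner_comm q p] at hd
  · exact .inl ⟨c + d, by linear_combination hc + hd⟩
  · exact .inr ⟨c + d, by linear_combination hc + hd⟩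
  · exact .inr ⟨c - d, by linear_combination hc - hd⟩
  · exact .inl ⟨c - d, by linear_combination hc - hd⟩

/-- If the squared length of a long root is `3`, then the root system is `G₂`, so its base has only
one short root. -/
lemma short_simple_unique [P.IsReduced] [P.IsIrreducible] [Nonempty ι] (hr : r = 3) {p q : ι}
    (hp : p ∈ b.support) (hq : q ∈ b.support) (hp1 : ℓ p = 1) (hq1 : ℓ q = 1) : p = q := by
  have hG : P.IsG2 := by
    by_contra hG
    rw [RootPairing.not_isG2_iff_isNotG2] at hG
    obtain ⟨u, hu⟩ := h.exists_short
    obtain ⟨v, hv⟩ := h.exists_long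
    obtain ⟨k, hk, hk'⟩ :=
      P.exists_form_eq_form_and_form_ne_zero (P.posRootForm ℤ).toInvariantForm u v
    obtain ⟨s, hs, hs'⟩ := h.exists_scale
    have hkr : ℓ k = 3 := by
      have h1 : (P.posRootForm ℤ).rootLength k = (P.posRootForm ℤ).rootLength v := by
        apply (algebraMap ℤ K).injective_int
        rw [RootPairing.RootPositiveForm.algebraMap_rootLength,
          RootPairing.RootPositiveForm.algebraMap_rootLength]
        exact hk
      rw [hs', hs', hv, hr] at h1
      exact mul_left_cancel₀ hs.ne' h1
    have huk : P.pairingIn ℤ u k ≠ 0 := by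
      intro h0
      apply hk'
      rw [RootPairing.InvariantForm.apply_root_root_zero_iff, ← P.algebraMap_pairingIn ℤ, h0,
        map_zero]
    have h2 := h.inner_comm u k
    have h3 := hG.pairingIn_mem_zero_one_two k u
    simp only [inner, hkr, hu, mul_one, Set.mem_insert_iff, Set.mem_singleton_iff] at h2 h3
    omega
  obtain ⟨v, hv, hv'⟩ := h.exists_mem_support_long b
  by_contra hpq
  have hvp : v ≠ p := by rintro rfl; omega
  have hvq : v ≠ q := by rintro rfl; omega
  classical
  have hsub : ({v, p, q} : Finset ι) ⊆ b.support := by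
    intro x hx
    simp only [Finset.mem_insert, Finset.mem_singleton] at hx
    rcases hx with rfl | rfl | rfl <;> assumption
  have hcard := Finset.card_le_card hsub
  rw [Finset.card_eq_three.mpr ⟨v, p, q, hvp, hvq, hpq, rfl⟩,
    RootPairing.IsG2.card_base_support_eq_two] at hcard
  omega

/-- Tameness can be read off from the base: only adjacent short simple roots can spoil it, and only
when the squared length of a long root is `2`. -/
lemma isTame [P.IsReduced] [P.IsIrreducible] [Nonempty ι]
    (hb : r = 2 → ∀ i ∈ b.support, ∀ j ∈ b.support, i ≠ j → ℓ i = 1 → ℓ j = 1 →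
      inner P ℓ i j = 0) : IsTame P ℓ r where
  toIsNormalizedLength := h
  inner_eq_zero hr i j hij hij' hi hj := by
    obtain ⟨p, hp, q, hq, hp1, hq1, hpq⟩ := h.dvd_inner_of_short b
      (fun i hi j hj hij hi1 hj1 => by rw [hb hr i hi j hj hij hi1 hj1]; exact dvd_zero r) hi hj
    have h1 := (h.inner_mem hij hij').1 hi hj
    have h2 : inner P ℓ p q = 2 ∨ inner P ℓ p q = 0 := by
      rcases eq_or_ne p q with rfl | hne
      · left; rw [inner_self, hp1]; rfl
      · right; exact hb hr p hp q hq hne hp1 hq1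
    subst hr
    omega
  inner_ne_zero hr i j hij hij' hi hj := by
    obtain ⟨p, hp, q, hq, hp1, hq1, hpq⟩ := h.dvd_inner_of_short b
      (fun i hi j hj hij hi1 hj1 => (hij (h.short_simple_unique b hr hi hj hi1 hj1)).elim) hi hj
    obtain rfl := h.short_simple_unique b hr hp hq hp1 hq1
    rw [inner_self, hp1, hr] at hpq
    omega

end IsNormalizedLength

end ShortRoots

end Diamond

/-! ### Diagrams with two lengths and their maximal chains -/

namespace Diamond

section Diagram

variable {V : Type*} [Fintype V] [DecidableEq V]

/-- The Gram matrix `F` of the simple roots of an irreducible root system in which a short root has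
squared length `ℓ = 1` and a long root has squared length `ℓ = 2`. The form is doubled, so that its
values are integers. -/
structure IsTwoLengthDiagram (F : Matrix V V ℤ) (ℓ : V → ℤ) : Prop where
  symm (u v : V) : F u v = F v u
  length (v : V) : ℓ v = 1 ∨ ℓ v = 2
  diag (v : V) : F v v = 2 * ℓ v
  short_short (u v : V) : u ≠ v → ℓ u = 1 → ℓ v = 1 → F u v = 0 ∨ F u v = -1
  long_left (u v : V) : u ≠ v → ℓ u = 2 → F u v = 0 ∨ F u v = -2
  pos (c : V → ℤ) : c ≠ 0 → 0 < Matrix.toBilin' F c c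
  connected (p : V → Prop) : (∃ v, p v) → (∀ u v, p u → F v u ≠ 0 → p v) → ∀ v, p v

/-- The vertices `v 0, …, v (p + q - 1)` form a chain in the diagram: consecutive ones are joined,
others are not, the first `p` of them are long and the last `q` are short. -/
structure IsChain (F : Matrix V V ℤ) (ℓ : V → ℤ) (v : ℕ → V) (p q : ℕ) : Prop where
  p_pos : 0 < p
  q_pos : 0 < q
  inj (a b : ℕ) : a < p + q → b < p + q → v a = v b → a = b
  long (a : ℕ) : a < p → ℓ (v a) = 2
  short (a : ℕ) : p ≤ a → a < p + q → ℓ (v a) = 1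
  adj_long (a : ℕ) : a < p → F (v a) (v (a + 1)) = -2
  adj_short (a : ℕ) : p ≤ a → a + 1 < p + q → F (v a) (v (a + 1)) = -1
  far (a b : ℕ) : a + 2 ≤ b → b < p + q → F (v a) (v b) = 0

variable {F : Matrix V V ℤ} {ℓ : V → ℤ}

namespace IsTwoLengthDiagram

variable (hF : IsTwoLengthDiagram F ℓ)
include hF

lemma long_right (u v : V) (huv : u ≠ v) (hv : ℓ v = 2) : F u v = 0 ∨ F u v = -2 := by
  rw [hF.symm]
  exact hF.long_left v u huv.symm hv

lemma nonpos (u v : V) (huv : u ≠ v) : F u v ≤ 0 := by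
  rcases hF.length u with hu | hu
  · rcases hF.length v with hv | hv
    · rcases hF.short_short u v huv hu hv with h | h <;> omega
    · rcases hF.long_right u v huv hv with h | h <;> omega
  · rcases hF.long_left u v huv hu with h | h <;> omega

lemma bilin_comm (c d : V → ℤ) : Matrix.toBilin' F c d = Matrix.toBilin' F d c := by
  rw [Matrix.toBilin'_apply, Matrix.toBilin'_apply, Finset.sum_comm]
  refine Finset.sum_congr rfl fun i _ => Finset.sum_congr rfl fun j _ => ?_
  rw [hF.symm j i]
  ring

end IsTwoLengthDiagram

namespace IsChain

variable {v : ℕ → V} {p q : ℕ} (hF : IsTwoLengthDiagram F ℓ) (hc : IsChain F ℓ v p q)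
include hF hc

/-- The sum of the long vertices from `v a` on: together they behave like a single long vertex. -/
lemma exists_long_contraction (a : ℕ) (ha : a < p) : ∃ c : V → ℤ,
    (∀ x, (∀ i < p + q, x ≠ v i) → c x = 0) ∧
    Matrix.toBilin' F c c = 4 ∧ Matrix.toBilin' F (Pi.single (v p) 1) c = -2 ∧
    (∀ b < a, Matrix.toBilin' F (Pi.single (v b) 1) c = if b + 1 = a then -2 else 0) ∧
    ∀ x, (∀ i < p + q, x ≠ v i) → Matrix.toBilin' F (Pi.single x 1) c ≤ 0 ∧
      Matrix.toBilin' F (Pi.single x 1) c ≤ F x (v a) := by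
  have hq := hc.q_pos
  obtain ⟨k, hk⟩ : ∃ k, p = a + 1 + k := ⟨p - (a + 1), by omega⟩
  induction k generalizing a with
  | zero =>
    refine ⟨Pi.single (v a) 1, fun x hx => ?_, ?_, ?_, fun b hb => ?_, fun x hx => ?_⟩
    · exact Pi.single_eq_of_ne (hx a (by omega)) 1
    · rw [Matrix.toBilin'_single, hF.diag, hc.long a ha]; rfl
    · rw [Matrix.toBilin'_single, hF.symm, show p = a + 1 by omega, hc.adj_long a ha]
    · rw [Matrix.toBilin'_single]
      split_ifs with h
      · rw [← h, hc.adj_long b (by omega)]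
      · exact hc.far b a (by omega) (by omega)
    · rw [Matrix.toBilin'_single]
      exact ⟨hF.nonpos _ _ (hx a (by omega)), le_rfl⟩
  | succ k ih =>
    obtain ⟨c, h1, h2, h3, h4, h5⟩ := ih (a + 1) (by omega) (by omega)
    refine ⟨Pi.single (v a) 1 + c, fun x hx => ?_, ?_, ?_, fun b hb => ?_, fun x hx => ?_⟩
    · rw [Pi.add_apply, h1 x hx, Pi.single_eq_of_ne (hx a (by omega)), add_zero]
    · have h6 := h4 a (by omega)
      rw [if_pos rfl] at h6
      rw [map_add, LinearMap.map_add₂, LinearMap.map_add₂, hF.bilin_comm c, h2, h6,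
        Matrix.toBilin'_single, hF.diag, hc.long a ha]
      rfl
    · rw [map_add, h3, Matrix.toBilin'_single, hF.symm, hc.far a p (by omega) (by omega)]
      rfl
    · rw [map_add, h4 b (by omega), if_neg (by omega), Matrix.toBilin'_single, add_zero]
      split_ifs with h
      · rw [← h, hc.adj_long b (by omega)]
      · exact hc.far b a (by omega) (by omega)
    · rw [map_add, Matrix.toBilin'_single]
      have h6 := h5 x hx
      have h7 := hF.nonpos _ _ (hx a (by omega))
      constructor <;> linarith

/-- The sum of the short vertices up to `v a`: together they behave like a single short vertex. -/
lemma exists_short_contraction (a : ℕ) (ha : p ≤ a) (ha' : a < p + q) : ∃ c : V → ℤ,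
    (∀ x, (∀ i < p + q, x ≠ v i) → c x = 0) ∧
    Matrix.toBilin' F c c = 2 ∧ Matrix.toBilin' F (Pi.single (v (p - 1)) 1) c = -2 ∧
    (∀ b, a < b → b < p + q →
      Matrix.toBilin' F (Pi.single (v b) 1) c = if a + 1 = b then -1 else 0) ∧
    ∀ x, (∀ i < p + q, x ≠ v i) → Matrix.toBilin' F (Pi.single x 1) c ≤ 0 ∧
      Matrix.toBilin' F (Pi.single x 1) c ≤ F x (v a) := by
  have hp := hc.p_pos
  induction a, ha using Nat.le_induction with
  | base =>
    refine ⟨Pi.single (v p) 1, fun x hx => ?_, ?_, ?_, fun b hb hb' => ?_, fun x hx => ?_⟩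
    · exact Pi.single_eq_of_ne (hx p (by omega)) 1
    · rw [Matrix.toBilin'_single, hF.diag, hc.short p le_rfl ha']; rfl
    · have := hc.adj_long (p - 1) (by omega)
      rw [Matrix.toBilin'_single]
      rwa [Nat.sub_add_cancel hp] at this
    · rw [Matrix.toBilin'_single, hF.symm]
      split_ifs with h
      · subst h
        exact hc.adj_short p le_rfl hb'
      · exact hc.far p b (by omega) hb'
    · rw [Matrix.toBilin'_single]
      exact ⟨hF.nonpos _ _ (hx p (by omega)), le_rfl⟩
  | succ a ha ih =>
    obtain ⟨c, h1, h2, h3, h4, h5⟩ := ih (by omega)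
    refine ⟨Pi.single (v (a + 1)) 1 + c, fun x hx => ?_, ?_, ?_, fun b hb hb' => ?_,
      fun x hx => ?_⟩
    · rw [Pi.add_apply, h1 x hx, Pi.single_eq_of_ne (hx (a + 1) ha'), add_zero]
    · have h6 := h4 (a + 1) (by omega) ha'
      rw [if_pos rfl] at h6
      rw [map_add, LinearMap.map_add₂, LinearMap.map_add₂, hF.bilin_comm c, h2, h6,
        Matrix.toBilin'_single, hF.diag, hc.short (a + 1) (by omega) ha']
      rfl
    · rw [map_add, h3, Matrix.toBilin'_single, hc.far (p - 1) (a + 1) (by omega) ha']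
      rfl
    · rw [map_add, h4 b (by omega) hb', if_neg (by omega), Matrix.toBilin'_single, add_zero,
        hF.symm]
      split_ifs with h
      · subst h
        exact hc.adj_short (a + 1) (by omega) hb'
      · exact hc.far (a + 1) b (by omega) hb'
    · rw [map_add, Matrix.toBilin'_single]
      have h6 := h5 x hx
      have h7 := hF.nonpos _ _ (hx (a + 1) ha')
      constructor <;> linarith

/-- A long vertex outside the chain can be joined only to its first vertex. -/
lemma eq_zero_of_long {x : V} (hx : ∀ i < p + q, x ≠ v i) (hx2 : ℓ x = 2) {a : ℕ}
    (ha : a < p + q) (hxa : F x (v a) ≠ 0) : a = 0 := by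
  have hp := hc.p_pos
  have hxa' : F x (v a) = -2 := (hF.long_left _ _ (hx a ha) hx2).resolve_left hxa
  by_contra ha0
  rcases lt_or_ge a p with hap | hap
  · -- The two long vertices `x` and `v (a - 1)` at one end of a chain with a double edge at the
    -- other end: an affine diagram, with a null vector.
    obtain ⟨c, h1, h2, h3, h4, h5⟩ := hc.exists_long_contraction hF a hap
    have h4' := h4 (a - 1) (by omega)
    rw [if_pos (by omega)] at h4'
    obtain ⟨-, h5⟩ := h5 x hx
    have e1 := hF.nonpos _ _ (hx (a - 1) (by omega))
    have e2 := hF.nonpos _ _ (hx p (by have := hc.q_pos; omega))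
    have e3 := hc.far (a - 1) p (by omega) (by have := hc.q_pos; omega)
    have hne : Pi.single x 1 + Pi.single (v (a - 1)) 1 + (2 : ℤ) • c +
        (2 : ℤ) • (Pi.single (v p) 1 : V → ℤ) ≠ 0 := by
      intro h0
      have := congrFun h0 x
      simp [h1 x hx, hx (a - 1) (by omega), hx p (by have := hc.q_pos; omega)] at this
    have := hF.pos _ hne
    simp only [map_add, LinearMap.add_apply, map_smul, LinearMap.smul_apply, smul_eq_mul,
      fun y => hF.bilin_comm c (Pi.single y 1), h2, h3, h4', Matrix.toBilin'_single, hF.diag,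
      hF.symm (v (a - 1)) x,
      hF.symm (v p) x, hF.symm (v p) (v (a - 1)), hx2, e3, hc.long (a - 1) (by omega),
      hc.short p le_rfl (by have := hc.q_pos; omega)] at this
    linarith
  · -- A chain with a double edge at both ends.
    obtain ⟨c, h1, h2, h3, h4, h5⟩ := hc.exists_short_contraction hF a hap ha
    obtain ⟨-, h5⟩ := h5 x hx
    have e1 := hF.nonpos _ _ (hx (p - 1) (by omega))
    have hne : Pi.single x 1 + Pi.single (v (p - 1)) 1 + (2 : ℤ) • c ≠ 0 := by
      intro h0
      have := congrFun h0 x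
      simp [h1 x hx, hx (p - 1) (by omega)] at this
    have := hF.pos _ hne
    simp only [map_add, LinearMap.add_apply, map_smul, LinearMap.smul_apply, smul_eq_mul,
      fun y => hF.bilin_comm c (Pi.single y 1), h2, h3, Matrix.toBilin'_single, hF.diag,
      hF.symm (v (p - 1)) x,
      hx2, hc.long (p - 1) (by omega)] at this
    linarith

/-- A short vertex outside the chain can be joined only to its last vertex. -/
lemma eq_last_of_short {x : V} (hx : ∀ i < p + q, x ≠ v i) (hx1 : ℓ x = 1) {a : ℕ}
    (ha : a < p + q) (hxa : F x (v a) ≠ 0) : a + 1 = p + q := by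
  have hp := hc.p_pos
  by_contra ha0
  rcases lt_or_ge a p with hap | hap
  · -- A chain with a double edge at both ends.
    have hxa' : F x (v a) = -2 :=
      (hF.long_right _ _ (hx a ha) (hc.long a hap)).resolve_left hxa
    obtain ⟨c, h1, h2, h3, h4, h5⟩ := hc.exists_long_contraction hF a hap
    obtain ⟨-, h5⟩ := h5 x hx
    have e2 := hF.nonpos _ _ (hx p (by have := hc.q_pos; omega))
    have hne : Pi.single x 1 + c + (Pi.single (v p) 1 : V → ℤ) ≠ 0 := by
      intro h0
      have := congrFun h0 x
      simp [h1 x hx, hx p (by have := hc.q_pos; omega)] at this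
    have := hF.pos _ hne
    simp only [map_add, LinearMap.add_apply,
      fun y => hF.bilin_comm c (Pi.single y 1), h2, h3, Matrix.toBilin'_single, hF.diag,
      hF.symm (v p) x, hx1, hc.short p le_rfl (by have := hc.q_pos; omega)] at this
    linarith
  · -- The two short vertices `x` and `v (a + 1)` at one end of a chain with a double edge at the
    -- other end: an affine diagram, with a null vector.
    have hxa' : F x (v a) = -1 :=
      (hF.short_short _ _ (hx a ha) hx1 (hc.short a hap ha)).resolve_left hxa
    obtain ⟨c, h1, h2, h3, h4, h5⟩ := hc.exists_short_contraction hF a hap ha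
    have h4' := h4 (a + 1) (by omega) (by omega)
    rw [if_pos rfl] at h4'
    obtain ⟨-, h5⟩ := h5 x hx
    have e1 := hF.nonpos _ _ (hx (p - 1) (by omega))
    have e2 := hF.nonpos _ _ (hx (a + 1) (by omega))
    have e3 := hc.far (p - 1) (a + 1) (by omega) (by omega)
    have hne : Pi.single x 1 + Pi.single (v (a + 1)) 1 + (2 : ℤ) • c +
        (Pi.single (v (p - 1)) 1 : V → ℤ) ≠ 0 := by
      intro h0
      have := congrFun h0 x
      simp [h1 x hx, hx (p - 1) (by omega), hx (a + 1) (by omega)] at this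
    have := hF.pos _ hne
    simp only [map_add, LinearMap.add_apply, map_smul, LinearMap.smul_apply, smul_eq_mul,
      fun y => hF.bilin_comm c (Pi.single y 1), h2, h3, h4', Matrix.toBilin'_single, hF.diag,
      hF.symm (v (p - 1)) x,
      hF.symm (v (a + 1)) x, hF.symm (v (a + 1)) (v (p - 1)), hx1, e3, hc.long (p - 1) (by omega),
      hc.short (a + 1) (by omega) (by omega)] at this
    linarith

lemma extend_front {x : V} (hx : ∀ i < p + q, x ≠ v i) (hx2 : ℓ x = 2) (hx0 : F x (v 0) ≠ 0) :
    IsChain F ℓ (fun n => Nat.casesOn n x v) (p + 1) q where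
  p_pos := by omega
  q_pos := hc.q_pos
  inj a b ha hb hab := by
    rcases a with _ | a <;> rcases b with _ | b
    · rfl
    · exact (hx b (by omega) hab).elim
    · exact (hx a (by omega) hab.symm).elim
    · rw [hc.inj a b (by omega) (by omega) hab]
  long a ha := by
    rcases a with _ | a
    · exact hx2
    · exact hc.long a (by omega)
  short a ha ha' := by
    rcases a with _ | a
    · omega
    · exact hc.short a (by omega) (by omega)
  adj_long a ha := by
    rcases a with _ | a
    · exact (hF.long_left _ _ (hx 0 (by have := hc.p_pos; omega)) hx2).resolve_left hx0
    · exact hc.adj_long a (by omega)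
  adj_short a ha ha' := by
    rcases a with _ | a
    · omega
    · exact hc.adj_short a (by omega) (by omega)
  far a b hab hb := by
    rcases b with _ | b
    · omega
    rcases a with _ | a
    · by_contra h
      have := hc.eq_zero_of_long hF hx hx2 (a := b) (by omega) h
      omega
    · exact hc.far a b (by omega) (by omega)

lemma extend_back {x : V} (hx : ∀ i < p + q, x ≠ v i) (hx1 : ℓ x = 1)
    (hx0 : F x (v (p + q - 1)) ≠ 0) :
    IsChain F ℓ (fun n => if n = p + q then x else v n) p (q + 1) where
  p_pos := hc.p_pos
  q_pos := by omega
  inj a b ha hb hab := by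
    split_ifs at hab with h1 h2 h2
    · omega
    · exact (hx b (by omega) hab).elim
    · exact (hx a (by omega) hab.symm).elim
    · exact hc.inj a b (by omega) (by omega) hab
  long a ha := by
    rw [if_neg (by omega)]
    exact hc.long a ha
  short a ha ha' := by
    split_ifs with h
    · exact hx1
    · exact hc.short a ha (by omega)
  adj_long a ha := by
    rw [if_neg (by omega), if_neg (by have := hc.q_pos; omega)]
    exact hc.adj_long a ha
  adj_short a ha ha' := by
    rw [if_neg (by omega)]
    split_ifs with h
    · obtain rfl : a = p + q - 1 := by omega
      rw [hF.symm]
      exact (hF.short_short _ _ (hx _ (by omega)) hx1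
        (hc.short _ (by omega) (by omega))).resolve_left hx0
    · exact hc.adj_short a ha (by omega)
  far a b hab hb := by
    rw [if_neg (by omega)]
    split_ifs with h
    · by_contra h'
      rw [hF.symm] at h'
      have := hc.eq_last_of_short hF hx hx1 (a := a) (by omega) h'
      omega
    · exact hc.far a b hab (by omega)

/-- The diagram is a chain, because a chain that does not exhaust it can be extended. -/
lemma exists_exhausting : ∃ v p q, IsChain F ℓ v p q ∧ ∀ x, ∃ i < p + q, x = v i := by
  obtain ⟨n, hn⟩ : ∃ n, Fintype.card V < p + q + n := ⟨Fintype.card V + 1, by omega⟩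
  induction n generalizing v p q with
  | zero =>
    have hinj : Function.Injective (fun i : Fin (p + q) => v i) :=
      fun a b hab => Fin.ext (hc.inj a b a.2 b.2 hab)
    have := Fintype.card_le_of_injective _ hinj
    rw [Fintype.card_fin] at this
    omega
  | succ n ih =>
    by_cases hall : ∀ x, ∃ i < p + q, x = v i
    · exact ⟨v, p, q, hc, hall⟩
    · obtain ⟨a, ha, x, hx, hxa⟩ : ∃ a < p + q, ∃ x, (∀ i < p + q, x ≠ v i) ∧
          F x (v a) ≠ 0 := by
        by_contra! hno
        refine hall (hF.connected _ ⟨v 0, 0, by have := hc.p_pos; omega, rfl⟩ ?_)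
        rintro _ x ⟨a, ha, rfl⟩ hxa
        by_contra! hx
        exact hxa (hno a ha x hx)
      rcases hF.length x with hx1 | hx2
      · have hlast := hc.eq_last_of_short hF hx hx1 ha hxa
        obtain rfl : a = p + q - 1 := by omega
        exact ih (hc.extend_back hF hx hx1 hxa) (by omega)
      · obtain rfl := hc.eq_zero_of_long hF hx hx2 ha hxa
        exact ih (hc.extend_front hF hx hx2 hxa) (by omega)

/-- Two long and three short vertices form an affine diagram. -/
lemma p_lt_two_of_three_le (hq : 3 ≤ q) : p < 2 := by
  by_contra! hp
  -- The null vector of the affine diagram.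
  have hne : Pi.single (v (p - 2)) 1 + (2 : ℤ) • Pi.single (v (p - 1)) 1 +
      (3 : ℤ) • Pi.single (v p) 1 + (2 : ℤ) • Pi.single (v (p + 1)) 1 +
      (Pi.single (v (p + 2)) 1 : V → ℤ) ≠ 0 := by
    intro h0
    have := congrFun h0 (v (p + 2))
    have hv : ∀ i, i < p + 2 → v (p + 2) ≠ v i := fun i hi e => by
      have := hc.inj _ _ (by omega) (by omega) e
      omega
    simp [hv (p - 2) (by omega), hv (p - 1) (by omega), hv p (by omega),
      hv (p + 1) (by omega)] at this
  have e1 := hc.adj_long (p - 2) (by omega)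
  have e2 := hc.adj_long (p - 1) (by omega)
  have e3 := hc.adj_short p le_rfl (by omega)
  have e4 := hc.adj_short (p + 1) (by omega) (by omega)
  rw [show p - 2 + 1 = p - 1 by omega] at e1
  rw [show p - 1 + 1 = p by omega] at e2
  rw [show p + 1 + 1 = p + 2 by omega] at e4
  have := hF.pos _ hne
  simp only [map_add, LinearMap.add_apply, map_smul, LinearMap.smul_apply, smul_eq_mul,
    Matrix.toBilin'_single, hF.diag, hF.symm (v (p - 1)) (v (p - 2)), hF.symm (v p) (v (p - 2)),
    hF.symm (v p) (v (p - 1)), hF.symm (v (p + 1)) (v (p - 2)), hF.symm (v (p + 1)) (v (p - 1)),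
    hF.symm (v (p + 1)) (v p), hF.symm (v (p + 2)) (v (p - 2)), hF.symm (v (p + 2)) (v (p - 1)),
    hF.symm (v (p + 2)) (v p), hF.symm (v (p + 2)) (v (p + 1)), e1, e2, e3, e4,
    hc.far (p - 2) p (by omega) (by omega), hc.far (p - 2) (p + 1) (by omega) (by omega),
    hc.far (p - 2) (p + 2) (by omega) (by omega), hc.far (p - 1) (p + 1) (by omega) (by omega),
    hc.far (p - 1) (p + 2) (by omega) (by omega), hc.far p (p + 2) (by omega) (by omega),
    hc.long (p - 2) (by omega), hc.long (p - 1) (by omega), hc.short p le_rfl (by omega),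
    hc.short (p + 1) (by omega) (by omega), hc.short (p + 2) (by omega) (by omega)] at this
  norm_num at this

/-- Three long and two short vertices form an affine diagram, the one of `F₄`. -/
lemma p_lt_three_of_two_le (hq : 2 ≤ q) : p < 3 := by
  by_contra! hp
  -- The null vector of the affine diagram.
  have hne : Pi.single (v (p - 3)) 1 + (2 : ℤ) • Pi.single (v (p - 2)) 1 +
      (3 : ℤ) • Pi.single (v (p - 1)) 1 + (4 : ℤ) • Pi.single (v p) 1 +
      (2 : ℤ) • (Pi.single (v (p + 1)) 1 : V → ℤ) ≠ 0 := by
    intro h0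
    have := congrFun h0 (v (p + 1))
    have hv : ∀ i, i < p + 1 → v (p + 1) ≠ v i := fun i hi e => by
      have := hc.inj _ _ (by omega) (by omega) e
      omega
    simp [hv (p - 3) (by omega), hv (p - 2) (by omega), hv (p - 1) (by omega),
      hv p (by omega)] at this
  have e1 := hc.adj_long (p - 3) (by omega)
  have e2 := hc.adj_long (p - 2) (by omega)
  have e3 := hc.adj_long (p - 1) (by omega)
  have e4 := hc.adj_short p le_rfl (by omega)
  rw [show p - 3 + 1 = p - 2 by omega] at e1
  rw [show p - 2 + 1 = p - 1 by omega] at e2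
  rw [show p - 1 + 1 = p by omega] at e3
  have := hF.pos _ hne
  simp only [map_add, LinearMap.add_apply, map_smul, LinearMap.smul_apply, smul_eq_mul,
    Matrix.toBilin'_single, hF.diag, hF.symm (v (p - 2)) (v (p - 3)),
    hF.symm (v (p - 1)) (v (p - 3)), hF.symm (v (p - 1)) (v (p - 2)),
    hF.symm (v p) (v (p - 3)), hF.symm (v p) (v (p - 2)), hF.symm (v p) (v (p - 1)),
    hF.symm (v (p + 1)) (v (p - 3)), hF.symm (v (p + 1)) (v (p - 2)),
    hF.symm (v (p + 1)) (v (p - 1)), hF.symm (v (p + 1)) (v p), e1, e2, e3, e4,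
    hc.far (p - 3) (p - 1) (by omega) (by omega), hc.far (p - 3) p (by omega) (by omega),
    hc.far (p - 3) (p + 1) (by omega) (by omega), hc.far (p - 2) p (by omega) (by omega),
    hc.far (p - 2) (p + 1) (by omega) (by omega), hc.far (p - 1) (p + 1) (by omega) (by omega),
    hc.long (p - 3) (by omega), hc.long (p - 2) (by omega), hc.long (p - 1) (by omega),
    hc.short p le_rfl (by omega), hc.short (p + 1) (by omega) (by omega)] at this
  norm_num at this

end IsChain

namespace IsTwoLengthDiagram

/-- A diagram with a long vertex and with two joined short vertices is a chain that has either only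
one long vertex, or two long and two short ones. -/
theorem exists_chain (hF : IsTwoLengthDiagram F ℓ) (hlong : ∃ u, ℓ u = 2)
    (hshort : ∃ u v, u ≠ v ∧ ℓ u = 1 ∧ ℓ v = 1 ∧ F u v ≠ 0) :
    ∃ v p q, IsChain F ℓ v p q ∧ (∀ x, ∃ i < p + q, x = v i) ∧
      (p = 1 ∧ 2 ≤ q ∨ p = 2 ∧ q = 2) := by
  obtain ⟨s, t, hst, hs, ht, -⟩ := hshort
  obtain ⟨u, w, hu, hw, huw⟩ : ∃ u w, ℓ u = 2 ∧ ℓ w = 1 ∧ F u w ≠ 0 := by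
    by_contra! hno
    have := hF.connected (fun v => ℓ v = 2) hlong (fun u v hu hvu => by
      rcases hF.length v with hv | hv
      · rw [hF.symm] at hvu
        exact (hvu (hno u v hu hv)).elim
      · exact hv) s
    omega
  have huw' : u ≠ w := by rintro rfl; omega
  have h0 : IsChain F ℓ (fun n => if n = 0 then u else w) 1 1 :=
    { p_pos := one_pos
      q_pos := one_pos
      inj := fun a b ha hb hab => by
        split_ifs at hab with h1 h2 h2
        · omega
        · exact (huw' hab).elim
        · exact (huw' hab.symm).elim
        · omega
      long := fun a ha => by rw [if_pos (by omega)]; exact hu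
      short := fun a ha _ => by rw [if_neg (by omega)]; exact hw
      adj_long := fun a ha => by
        rw [if_pos (by omega), if_neg (by omega)]
        exact (hF.long_left u w huw' hu).resolve_left huw
      adj_short := fun a ha ha' => by omega
      far := fun a b hab hb => by omega }
  obtain ⟨v, p, q, hc, hall⟩ := h0.exists_exhausting hF
  have hp := hc.p_pos
  have hq : 2 ≤ q := by
    by_contra! hq
    have : ∀ x, ℓ x = 1 → x = v p := by
      intro x hx
      obtain ⟨i, hi, rfl⟩ := hall x
      have : ¬ i < p := fun h => by have := hc.long i h; omega
      rw [show i = p by omega]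
    exact hst ((this s hs).trans (this t ht).symm)
  refine ⟨v, p, q, hc, hall, ?_⟩
  have h3 := hc.p_lt_three_of_two_le hF hq
  by_cases hq3 : 3 ≤ q
  · have := hc.p_lt_two_of_three_le hF hq3
    omega
  · omega

end IsTwoLengthDiagram

/-- An exhausting chain is an enumeration of the diagram. -/
noncomputable def IsChain.equiv {v : ℕ → V} {p q : ℕ} (hc : IsChain F ℓ v p q)
    (hall : ∀ x, ∃ i < p + q, x = v i) : Fin (p + q) ≃ V :=
  Equiv.ofBijective (fun i => v i)
    ⟨fun a b hab => Fin.ext (hc.inj a b a.2 b.2 hab), fun x => by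
      obtain ⟨i, hi, rfl⟩ := hall x
      exact ⟨⟨i, hi⟩, rfl⟩⟩

omit [Fintype V] [DecidableEq V] in
lemma IsChain.equiv_apply {v : ℕ → V} {p q : ℕ} (hc : IsChain F ℓ v p q)
    (hall : ∀ x, ∃ i < p + q, x = v i) (i : Fin (p + q)) : hc.equiv hall i = v i :=
  rfl

/-- A diagram with a long vertex and with two joined short vertices is of type `Cₙ`, with `n > 2`,
or of type `F₄`. -/
theorem IsTwoLengthDiagram.sameDynkinGraph {A : Matrix V V ℤ} (hF : IsTwoLengthDiagram F ℓ)
    (hA : ∀ u v, A u v * ℓ v = F u v) (hlong : ∃ u, ℓ u = 2)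
    (hshort : ∃ u v, u ≠ v ∧ ℓ u = 1 ∧ ℓ v = 1 ∧ F u v ≠ 0) :
    (∃ n : ℕ, 2 < n ∧ SameDynkinGraph A (CartanMatrix.C n)) ∨
      SameDynkinGraph A CartanMatrix.F₄ := by
  obtain ⟨v, p, q, hc, hall, ⟨rfl, hq⟩ | ⟨rfl, rfl⟩⟩ := hF.exists_chain hlong hshort
  · left
    -- The long simple root of `Cₙ` comes last.
    refine ⟨1 + q, by omega, (hc.equiv hall).symm.trans Fin.revPerm, ?_⟩
    suffices ∀ i j : Fin (1 + q), A (v i) (v j) = CartanMatrix.C (1 + q) i.rev j.rev by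
      intro i j
      have := this ((hc.equiv hall).symm i) ((hc.equiv hall).symm j)
      rw [← hc.equiv_apply hall, ← hc.equiv_apply hall, Equiv.apply_symm_apply,
        Equiv.apply_symm_apply] at this
      exact this
    intro i j
    have hij := hA (v i) (v j)
    obtain ⟨i, hi⟩ := i
    obtain ⟨j, hj⟩ := j
    simp only [CartanMatrix.C, Matrix.of_apply, Fin.ext_iff, Fin.val_rev] at hij ⊢
    rcases lt_trichotomy i j with h | rfl | h
    · rw [hc.short j (by omega) hj, mul_one] at hij
      rw [hij]
      rcases Nat.lt_or_ge (i + 1) j with h' | h'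
      · rw [hc.far i j (by omega) hj]
        split_ifs <;> omega
      · obtain rfl : j = i + 1 := by omega
        rcases Nat.eq_zero_or_pos i with rfl | hi0
        · rw [hc.adj_long 0 one_pos]
          split_ifs <;> omega
        · rw [hc.adj_short i hi0 hj]
          split_ifs <;> omega
    · rw [hF.diag] at hij
      rw [if_pos rfl]
      rcases hF.length (v i) with hℓ | hℓ <;> rw [hℓ] at hij <;> omega
    · rw [hF.symm] at hij
      rcases Nat.lt_or_ge (j + 1) i with h' | h'
      · rw [hc.far j i (by omega) hi] at hij
        rcases hF.length (v j) with hℓ | hℓ <;> rw [hℓ] at hij <;> split_ifs <;> omega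
      · obtain rfl : i = j + 1 := by omega
        rcases Nat.eq_zero_or_pos j with rfl | hj0
        · rw [hc.adj_long 0 one_pos, hc.long 0 one_pos] at hij
          split_ifs <;> omega
        · rw [hc.adj_short j hj0 hi, hc.short j hj0 hj] at hij
          split_ifs <;> omega
  · right
    refine ⟨(hc.equiv hall).symm, ?_⟩
    suffices ∀ i j : Fin 4, A (v i) (v j) = CartanMatrix.F₄ i j by
      intro i j
      have := this ((hc.equiv hall).symm i) ((hc.equiv hall).symm j)
      rw [← hc.equiv_apply hall, ← hc.equiv_apply hall, Equiv.apply_symm_apply,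
        Equiv.apply_symm_apply] at this
      exact this
    have e1 : F (v 0) (v 1) = -2 := hc.adj_long 0 (by omega)
    have e2 : F (v 1) (v 2) = -2 := hc.adj_long 1 (by omega)
    have e3 : F (v 2) (v 3) = -1 := hc.adj_short 2 le_rfl (by omega)
    have e4 : F (v 0) (v 2) = 0 := hc.far 0 2 (by omega) (by omega)
    have e5 : F (v 0) (v 3) = 0 := hc.far 0 3 (by omega) (by omega)
    have e6 : F (v 1) (v 3) = 0 := hc.far 1 3 (by omega) (by omega)
    have l0 := hc.long 0 (by omega)
    have l1 := hc.long 1 (by omega)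
    have l2 := hc.short 2 le_rfl (by omega)
    have l3 := hc.short 3 (by omega) (by omega)
    intro i j
    have hij := hA (v i) (v j)
    fin_cases i <;> fin_cases j <;>
      simp [CartanMatrix.F₄, hF.diag, hF.symm (v 1) (v 0), hF.symm (v 2) (v 0),
        hF.symm (v 2) (v 1), hF.symm (v 3) (v 0), hF.symm (v 3) (v 1), hF.symm (v 3) (v 2),
        e1, e2, e3, e4, e5, e6, l0, l1, l2, l3] at hij ⊢ <;> omega

end Diagram

end Diamond

/-! ### Root systems that are not of type `Cₙ` or `F₄` -/

namespace Diamond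

open Set Matrix

variable {ι K M N : Type*} [Fintype ι] [Field K] [CharZero K] [AddCommGroup M] [Module K M]
  [AddCommGroup N] [Module K N] {P : RootPairing ι K M N} [P.IsCrystallographic]
  {ℓ : ι → ℤ} {r : ℤ}

namespace IsNormalizedLength

variable (h : IsNormalizedLength P ℓ r) (b : P.Base)
include h

lemma toBilin'_pos [P.IsRootSystem] [DecidableEq ι] (c : b.support → ℤ) (hc : c ≠ 0) :
    0 < Matrix.toBilin' (.of fun u v : b.support => inner P ℓ u v) c c := by
  obtain ⟨s, hs, hs'⟩ := h.exists_scale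
  set d : b.support → ℤ := fun i => P.RootFormIn ℤ (P.rootSpanMem ℤ i) (P.rootSpanMem ℤ i) with hd
  have hds : ∀ i, d i = s * ℓ i := by
    intro i
    rw [← hs', RootPairing.RootPositiveForm.rootLength, RootPairing.posRootForm_eq]
  have hpos : (b.cartanMatrix * diagonal d).PosDef := by
    rw [RootPairing.Base.cartanMatrix_mul_diagonal_eq]
    refine Matrix.PosDef.smul ?_ two_pos
    have aux : (P.posRootForm ℤ).posForm.IsSymm := by
      simpa only [RootPairing.posRootForm_eq, LinearMap.BilinForm.isSymm_iff] using
        P.rootFormIn_isSymm ℤ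
    rw [← LinearMap.BilinForm.posDef_toQuadraticMap_iff_matrix _ _ aux]
    simpa using P.posRootForm_rootFormIn_posDef ℤ
  have h1 := hpos.dotProduct_mulVec_pos hc
  have h2 : b.cartanMatrix * diagonal d = s • .of fun u v : b.support => inner P ℓ u v := by
    ext u v
    rw [mul_diagonal, hds, Matrix.smul_apply, smul_eq_mul, mul_left_comm]
    rfl
  rw [h2, Matrix.smul_mulVec, dotProduct_smul, smul_eq_mul, star_trivial] at h1
  rw [Matrix.toBilin'_apply']
  exact pos_of_mul_pos_right h1 hs.le

/-- The simple roots of a root system with roots of squared lengths `1` and `2` form a diagram with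
two lengths. -/
lemma isTwoLengthDiagram [P.IsReduced] [P.IsIrreducible] [P.IsRootSystem] [DecidableEq ι]
    (hr : r = 2) :
    IsTwoLengthDiagram (.of fun u v : b.support => inner P ℓ u v) (fun u => ℓ u) where
  symm u v := h.inner_comm u v
  length v := hr ▸ h.eq_or v
  diag v := inner_self (v : ι)
  short_short u v huv hu hv := by
    have h1 := (h.inner_mem (Subtype.coe_injective.ne huv)
      (b.root_ne_neg_of_ne u.2 v.2 (Subtype.coe_injective.ne huv))).1 hu hv
    have h2 := b.pairingIn_le_zero_of_ne (Subtype.coe_injective.ne huv) u.2 v.2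
    have h3 : inner P ℓ u v ≤ 0 := mul_nonpos_of_nonpos_of_nonneg h2 (h.pos v).le
    rw [Matrix.of_apply]
    omega
  long_left u v huv hu := by
    have h1 := (h.inner_mem (Subtype.coe_injective.ne huv)
      (b.root_ne_neg_of_ne u.2 v.2 (Subtype.coe_injective.ne huv))).2 (.inl (hu.trans hr.symm))
    have h2 := b.pairingIn_le_zero_of_ne (Subtype.coe_injective.ne huv) u.2 v.2
    have h3 : inner P ℓ u v ≤ 0 := mul_nonpos_of_nonpos_of_nonneg h2 (h.pos v).le
    rw [Matrix.of_apply]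
    omega
  pos c hc := h.toBilin'_pos b c hc
  connected p := by
    rintro ⟨u, hu⟩ hp v
    refine b.induction_on_cartanMatrix p hu fun i j hi hij => hp i j hi ?_
    rw [Matrix.of_apply]
    exact mul_ne_zero hij (h.pos i).ne'

/-- An irreducible root system that is not of type `Cₙ`, with `n > 2`, or `F₄` is tame. -/
theorem isTame_of_not_sameDynkinGraph [P.IsReduced] [P.IsIrreducible] [P.IsRootSystem] [Nonempty ι]
    (hb : ¬ ((∃ n : ℕ, 2 < n ∧ SameDynkinGraph b.cartanMatrix (CartanMatrix.C n)) ∨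
      SameDynkinGraph b.cartanMatrix CartanMatrix.F₄)) : IsTame P ℓ r := by
  classical
  refine h.isTame b fun hr i hi j hj hij hi1 hj1 => ?_
  by_contra hne
  obtain ⟨u, hu, hu2⟩ := h.exists_mem_support_long b
  exact hb ((h.isTwoLengthDiagram b hr).sameDynkinGraph (fun _ _ => rfl) ⟨⟨u, hu⟩, hu2.trans hr⟩
    ⟨⟨i, hi⟩, ⟨j, hj⟩, fun e => hij (congrArg Subtype.val e), hi1, hj1, hne⟩)

end IsNormalizedLength

end Diamond

/-! ### Bracket monomials in a ring graded by a root system -/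

namespace Diamond

open Set

section EqUpToSign

variable {𝔤 : Type*} [LieRing 𝔤] {x x' y y' z : 𝔤} {S : Set 𝔤}

lemma eqUpToSign_refl (x : 𝔤) : EqUpToSign x x := .inl rfl

lemma eqUpToSign_symm (h : EqUpToSign x y) : EqUpToSign y x :=
  h.imp Eq.symm fun h => by rw [h, neg_neg]

lemma eqUpToSign_trans (h : EqUpToSign x y) (h' : EqUpToSign y z) : EqUpToSign x z := by
  rcases h with rfl | rfl <;> rcases h' with rfl | rfl
  · exact .inl rfl
  · exact .inr rfl
  · exact .inr rfl
  · exact .inl (neg_neg z)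

lemma eqUpToSign_lie (h : EqUpToSign x x') (h' : EqUpToSign y y') :
    EqUpToSign ⁅x, y⁆ ⁅x', y'⁆ := by
  rcases h with rfl | rfl <;> rcases h' with rfl | rfl
  · exact .inl rfl
  · exact .inr (lie_neg _ _)
  · exact .inr (neg_lie _ _)
  · exact .inl (by rw [neg_lie, lie_neg, neg_neg])

lemma eqUpToSign_lie_swap (x y : 𝔤) : EqUpToSign ⁅x, y⁆ ⁅y, x⁆ :=
  .inr (lie_skew x y).symm

lemma ne_zero_of_eqUpToSign (h : EqUpToSign x y) (hy : y ≠ 0) : x ≠ 0 := by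
  rcases h with rfl | rfl
  · exact hy
  · exact neg_ne_zero.mpr hy

lemma memUpToSign_of_eqUpToSign (h : EqUpToSign x y) (hy : y ∈ S) : MemUpToSign x S := by
  rcases h with rfl | rfl
  · exact .inl hy
  · exact .inr (by rwa [neg_neg])

lemma exists_eqUpToSign_of_memUpToSign (h : MemUpToSign x S) : ∃ y ∈ S, EqUpToSign x y :=
  h.elim (fun h => ⟨x, h, .inl rfl⟩) fun h => ⟨-x, h, .inr (neg_neg x).symm⟩

end EqUpToSign

section Positive

variable {ι K M N : Type*} [Field K] [CharZero K] [AddCommGroup M] [Module K M]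
  [AddCommGroup N] [Module K N] {P : RootPairing ι K M N} {b : P.Base} {i j k : ι}

lemma exists_isPos_of_sub_mem_range (h : P.root i - P.root j ∈ range P.root) :
    (∃ d, b.IsPos d ∧ P.root i = P.root j + P.root d) ∨
      ∃ d, b.IsPos d ∧ P.root j = P.root i + P.root d := by
  let := P.indexNeg
  obtain ⟨d, hd⟩ := h
  rcases RootPairing.Base.IsPos.or_neg b d with h | h
  · exact .inl ⟨d, h, by rw [hd]; abel⟩
  · exact .inr ⟨-d, h, by
      rw [P.indexNeg_neg, P.root_reflectionPerm, P.reflection_apply_self, hd]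
      abel⟩

lemma root_add_root_ne_zero (hi : b.IsPos i) (hj : b.IsPos j) : P.root i + P.root j ≠ 0 := by
  let := P.indexNeg
  intro h
  have : i = -j := P.root.injective <| by
    rw [P.indexNeg_neg, P.root_reflectionPerm, P.reflection_apply_self]
    exact eq_neg_of_add_eq_zero_left h
  rw [this, RootPairing.Base.IsPos.neg_iff_not] at hi
  exact hi hj

lemma root_ne_neg_root (hi : b.IsPos i) (hj : b.IsPos j) : P.root i ≠ -P.root j := fun h =>
  root_add_root_ne_zero hi hj (by rw [h, neg_add_cancel])

end Positive

variable {ι K M N : Type*} [Field K] [AddCommGroup M] [Module K M] [AddCommGroup N] [Module K N]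
  {𝔤 : Type*} [LieRing 𝔤]

/-- A family of subgroups of a Lie ring behaves like the weight spaces of a semisimple Lie algebra:
only roots and `0` are weights, the bracket is additive on weights, it does not vanish on root
vectors whose weights add up to a root, and root vectors of different weights are independent. -/
structure IsRootGrading (P : RootPairing ι K M N) (V : M → AddSubgroup 𝔤) : Prop where
  lie_mem {μ ν : M} {x y : 𝔤} : x ∈ V μ → y ∈ V ν → ⁅x, y⁆ ∈ V (μ + ν)
  eq_zero {μ : M} {x : 𝔤} : μ ≠ 0 → μ ∉ range P.root → x ∈ V μ → x = 0
  lie_ne_zero {i j k : ι} {x y : 𝔤} : P.root k = P.root i + P.root j → x ∈ V (P.root i) →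
    y ∈ V (P.root j) → x ≠ 0 → y ≠ 0 → ⁅x, y⁆ ≠ 0
  linearIndepOn (s : Set ι) (e : ι → 𝔤) : (∀ i ∈ s, e i ∈ V (P.root i) ∧ e i ≠ 0) →
    LinearIndepOn ℤ e s

variable {P : RootPairing ι K M N} {V : M → AddSubgroup 𝔤}

namespace IsRootGrading

variable (hV : IsRootGrading P V)
include hV

lemma lie_eq_zero {μ ν : M} {x y : 𝔤} (h0 : μ + ν ≠ 0) (h : μ + ν ∉ range P.root) (hx : x ∈ V μ)
    (hy : y ∈ V ν) : ⁅x, y⁆ = 0 :=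
  hV.eq_zero h0 h (hV.lie_mem hx hy)

lemma zsmul_ne_zero {i : ι} {x : 𝔤} (hx : x ∈ V (P.root i)) (hx0 : x ≠ 0) {n : ℤ} (hn : n ≠ 0) :
    n • x ≠ 0 := by
  intro h
  have h1 := hV.linearIndepOn {i} (fun _ => x) (by rintro j rfl; exact ⟨hx, hx0⟩)
  exact hn (linearIndependent_iff'.mp h1 {⟨i, rfl⟩} (fun _ => n) (by simpa using h) ⟨i, rfl⟩
    (by simp))

lemma eq_of_eqUpToSign {i j : ι} {x y : 𝔤} (hx : x ∈ V (P.root i)) (hy : y ∈ V (P.root j))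
    (hx0 : x ≠ 0) (h : EqUpToSign x y) : i = j := by
  classical
  by_contra hij
  have hx' : x ∈ V (P.root j) := by
    rcases h with rfl | rfl
    · exact hy
    · exact neg_mem hy
  have h1 := hV.linearIndepOn {i, j} (fun _ => x) (by rintro k (rfl | rfl) <;> simp [*])
  exact hij (h1.injOn (by simp) (by simp) rfl)

end IsRootGrading

/-- The root vectors that are obtained from given root vectors `x i` of simple roots by forming
brackets. -/
inductive IsMonomial {b : P.Base} (x : b.support → 𝔤) : ι → 𝔤 → Prop
  | simple (i : b.support) : IsMonomial x i (x i)
  | lie {i j k : ι} {y z : 𝔤} (h : P.root k = P.root i + P.root j) (hy : IsMonomial x i y)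
      (hz : IsMonomial x j z) : IsMonomial x k ⁅y, z⁆

namespace IsMonomial

variable {b : P.Base} {x : b.support → 𝔤} {i j k : ι} {y z : 𝔤}

lemma isPos [CharZero K] (hy : IsMonomial x k y) : b.IsPos k := by
  induction hy with
  | simple i => exact b.isPos_of_mem_support i.2
  | lie h _ _ hi hj => exact hi.add hj h

lemma mem (hV : IsRootGrading P V) (hx : ∀ i : b.support, x i ∈ V (P.root i))
    (hy : IsMonomial x k y) :
    y ∈ V (P.root k) := by
  induction hy with
  | simple i => exact hx i
  | lie h _ _ hi hj => exact h ▸ hV.lie_mem hi hj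

lemma ne_zero (hV : IsRootGrading P V) (hx : ∀ i : b.support, x i ∈ V (P.root i))
    (hx0 : ∀ i, x i ≠ 0) (hy : IsMonomial x k y) : y ≠ 0 := by
  induction hy with
  | simple i => exact hx0 i
  | lie h hy hz hi hj => exact hV.lie_ne_zero h (hy.mem hV hx) (hz.mem hV hx) hi hj

end IsMonomial

lemma exists_isMonomial [Finite ι] [CharZero K] [P.IsCrystallographic] {b : P.Base}
    (x : b.support → 𝔤) {k : ι} (hk : b.IsPos k) : ∃ y, IsMonomial x k y := by
  refine hk.induction_on_add (p := fun k => ∃ y, IsMonomial x k y)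
    (fun i hi => ⟨_, .simple ⟨i, hi⟩⟩) fun i j k h hi hj => ?_
  obtain ⟨y, hy⟩ := hi
  exact ⟨_, .lie h hy (.simple ⟨j, hj⟩)⟩

section Unique

variable [Fintype ι] [CharZero K] [P.IsCrystallographic] [P.IsReduced] {ℓ : ι → ℤ} {r : ℤ}
  {b : P.Base} {x : b.support → 𝔤}

/-- If `i = i' + d` and `j' = d + j`, then bracket monomials for the sums `i + j` and `i' + j'`
agree up to sign, by the Jacobi identity: `i' + j` is not a root. -/
lemma eqUpToSign_lie_lie_of_add (h : IsTame P ℓ r) (hV : IsRootGrading P V)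
    (hx : ∀ i : b.support, x i ∈ V (P.root i)) {i j i' j' d k : ι} {y z y' z' w : 𝔤}
    (hk : P.root k = P.root i + P.root j)
    (hd : P.root i = P.root i' + P.root d) (hd' : P.root j' = P.root d + P.root j)
    (hz : IsMonomial x j z) (hy' : IsMonomial x i' y')
    (h1 : EqUpToSign y ⁅y', w⁆) (h2 : EqUpToSign z' ⁅w, z⁆) :
    EqUpToSign ⁅y, z⁆ ⁅y', z'⁆ := by
  have h0 : ⁅y', z⁆ = 0 := by
    refine hV.lie_eq_zero (root_add_root_ne_zero hy'.isPos hz.isPos) ?_ (hy'.mem hV hx)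
      (hz.mem hV hx)
    rintro ⟨s, hs⟩
    exact h.no_triangle hd hd' hs (by rw [hk, hd])
  refine eqUpToSign_trans (eqUpToSign_lie h1 (eqUpToSign_refl z)) ?_
  refine eqUpToSign_trans ?_ (eqUpToSign_lie (eqUpToSign_refl y') (eqUpToSign_symm h2))
  rw [lie_lie, h0, lie_zero, sub_zero]
  exact eqUpToSign_refl _

/-- In the tame case two bracket monomials of the same weight agree up to sign. -/
theorem IsMonomial.eqUpToSign (h : IsTame P ℓ r) (hV : IsRootGrading P V)
    (hx : ∀ i : b.support, x i ∈ V (P.root i)) {k : ι} {y z : 𝔤} (hy : IsMonomial x k y)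
    (hz : IsMonomial x k z) : EqUpToSign y z := by
  obtain ⟨n, hn⟩ : ∃ n : ℕ, b.height k < n := ⟨(b.height k).toNat + 1, by omega⟩
  induction n generalizing k y z with
  | zero =>
    have := hy.isPos
    rw [RootPairing.Base.isPos_iff] at this
    omega
  | succ n ih =>
    have hsplit : ∀ {i j : ι}, b.IsPos i → b.IsPos j → P.root k = P.root i + P.root j →
        1 < b.height k ∧ b.height i < n ∧ b.height j < n := by
      intro i j hi hj hk
      rw [RootPairing.Base.isPos_iff] at hi hj
      rw [b.height_add hk] at hn ⊢
      push_cast at hn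
      omega
    have hlie : ∀ {i j i' j' : ι} {y z y' z' : 𝔤}, P.root k = P.root i + P.root j →
        P.root k = P.root i' + P.root j' → IsMonomial x i y → IsMonomial x j z →
        IsMonomial x i' y' → IsMonomial x j' z' → P.root i - P.root i' ∈ range P.root →
        EqUpToSign ⁅y, z⁆ ⁅y', z'⁆ := by
      intro i j i' j' y z y' z' hk hk' hy hz hy' hz' hd
      obtain ⟨-, hi, hj⟩ := hsplit hy.isPos hz.isPos hk
      obtain ⟨-, hi', hj'⟩ := hsplit hy'.isPos hz'.isPos hk'
      have hkk := hk.symm.trans hk'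
      rcases exists_isPos_of_sub_mem_range (b := b) hd with ⟨d, hdp, hd⟩ | ⟨d, hdp, hd⟩
      · obtain ⟨w, hw⟩ := exists_isMonomial x hdp
        have hd' : P.root j' = P.root d + P.root j := by
          rw [hd, add_assoc] at hkk
          exact (add_left_cancel hkk).symm
        exact eqUpToSign_lie_lie_of_add h hV hx hk hd hd' hz hy' (ih hy (.lie hd hy' hw) hi)
          (ih hz' (.lie hd' hw hz) hj')
      · obtain ⟨w, hw⟩ := exists_isMonomial x hdp
        have hd' : P.root j = P.root d + P.root j' := by
          rw [hd, add_assoc] at hkk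
          exact add_left_cancel hkk
        exact eqUpToSign_symm (eqUpToSign_lie_lie_of_add h hV hx hk' hd hd' hz' hy
          (ih hy' (.lie hd hy hw) hi') (ih hz (.lie hd' hw hz') hj))
    generalize hkk : k = k' at hz
    cases hy with
    | simple i =>
      cases hz with
      | simple j =>
        rw [Subtype.ext hkk]
        exact eqUpToSign_refl _
      | lie hk' hy' hz' =>
        subst hkk
        have := (hsplit hy'.isPos hz'.isPos hk').1
        rw [b.height_one_of_mem_support i.2] at this
        omega
    | @lie i j _ y z hk hy hz₁ =>
      cases hz with
      | simple i =>
        subst hkk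
        have := (hsplit hy.isPos hz₁.isPos hk).1
        rw [b.height_one_of_mem_support i.2] at this
        omega
      | @lie i' j' _ y' z' hk' hy' hz' =>
        subst hkk
        obtain ⟨-, hi, hj⟩ := hsplit hy.isPos hz₁.isPos hk
        have hkk := hk.symm.trans hk'
        by_cases h1 : i = i'
        · subst h1
          obtain rfl := P.root.injective (add_left_cancel hkk)
          exact eqUpToSign_lie (ih hy hy' hi) (ih hz₁ hz' hj)
        by_cases h2 : i = j'
        · subst h2
          rw [add_comm (P.root i')] at hkk
          obtain rfl := P.root.injective (add_left_cancel hkk)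
          exact eqUpToSign_trans (eqUpToSign_lie (ih hy hz' hi) (ih hz₁ hy' hj))
            (eqUpToSign_lie_swap _ _)
        have h3 : j ≠ i' := by
          rintro rfl
          rw [add_comm (P.root j)] at hkk
          exact h2 (P.root.injective (add_right_cancel hkk))
        have h4 : j ≠ j' := by
          rintro rfl
          exact h1 (P.root.injective (add_right_cancel hkk))
        rcases (h.sub_mem_range_or_and_not_and hk hk' h1 h2 h3 h4
          (root_ne_neg_root hy.isPos hy'.isPos) (root_ne_neg_root hy.isPos hz'.isPos)
          (root_ne_neg_root hz₁.isPos hy'.isPos) (root_ne_neg_root hz₁.isPos hz'.isPos)).1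
          with hd | hd
        · exact hlie hk hk' hy hz₁ hy' hz' hd
        · exact eqUpToSign_trans (hlie hk (by rw [hk', add_comm]) hy hz₁ hz' hy' hd)
            (eqUpToSign_lie_swap _ _)

end Unique

end Diamond

/-! ### The diamond root system of a tame grading -/

namespace Diamond

open Set

variable {ι K M N : Type*} [Field K] [CharZero K] [AddCommGroup M] [Module K M] [AddCommGroup N]
  [Module K N] {𝔤 : Type*} [LieRing 𝔤] {P : RootPairing ι K M N} {V : M → AddSubgroup 𝔤}
  {b : P.Base}

/-- Root vectors for the positive roots such that the bracket of two of them is, up to sign, another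
one of them whenever the sum of their weights is a root. -/
structure IsBracketClosed (V : M → AddSubgroup 𝔤) (e : {i : ι // b.IsPos i} → 𝔤) : Prop where
  mem (i : {i : ι // b.IsPos i}) : e i ∈ V (P.root i)
  ne_zero (i : {i : ι // b.IsPos i}) : e i ≠ 0
  lie (i j k : {i : ι // b.IsPos i}) : P.root k = P.root i + P.root j → EqUpToSign ⁅e i, e j⁆ (e k)

namespace IsBracketClosed

variable {e : {i : ι // b.IsPos i} → 𝔤} (he : IsBracketClosed V e) (hV : IsRootGrading P V)
  {i j k l m : {i : ι // b.IsPos i}}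
include he hV

lemma eq_of_eqUpToSign (h : EqUpToSign (e i) (e j)) : i = j :=
  Subtype.ext (hV.eq_of_eqUpToSign (he.mem i) (he.mem j) (he.ne_zero i) h)

lemma exists_add_of_lie_ne_zero (h : ⁅e i, e j⁆ ≠ 0) :
    ∃ k : {i : ι // b.IsPos i}, P.root k = P.root i + P.root j := by
  by_contra! hne
  refine h (hV.lie_eq_zero (root_add_root_ne_zero i.2 j.2) ?_ (he.mem i) (he.mem j))
  rintro ⟨k, hk⟩
  exact hne ⟨k, i.2.add j.2 hk⟩ hk

lemma add_of_eqUpToSign (h : EqUpToSign ⁅e i, e j⁆ (e k)) :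
    P.root k = P.root i + P.root j := by
  obtain ⟨l, hl⟩ := he.exists_add_of_lie_ne_zero hV (ne_zero_of_eqUpToSign h (he.ne_zero k))
  have := he.eq_of_eqUpToSign hV (eqUpToSign_trans (eqUpToSign_symm h) (he.lie i j l hl))
  rwa [this]

lemma exists_add_of_memUpToSign (h : MemUpToSign ⁅e i, e j⁆ (range e)) :
    ∃ k : {i : ι // b.IsPos i}, P.root k = P.root i + P.root j ∧ EqUpToSign ⁅e i, e j⁆ (e k) := by
  obtain ⟨_, ⟨k, rfl⟩, hk⟩ := exists_eqUpToSign_of_memUpToSign h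
  exact ⟨k, he.add_of_eqUpToSign hV hk, hk⟩

lemma ne_of_add (h : P.root k = P.root i + P.root j) : i ≠ j := by
  rintro rfl
  exact hV.lie_ne_zero h (he.mem i) (he.mem i) (he.ne_zero i) (he.ne_zero i) (lie_self _)

section Tame

variable [Fintype ι] [P.IsCrystallographic] [P.IsReduced] {ℓ : ι → ℤ} {r : ℤ} (h : IsTame P ℓ r)
include h

/-- Roots `i`, `j`, `k` such that `i + j`, `j + k` and `i + j + k` are roots are adjacent. -/
lemma isAdjacent {p q t : {i : ι // b.IsPos i}} (hp : P.root p = P.root i + P.root j)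
    (hq : P.root q = P.root j + P.root k) (ht : P.root t = P.root i + P.root j + P.root k)
    (hik : i ≠ k) : IsAdjacent (range e) (e i) (e j) (e k) := by
  have h0 : ⁅e i, e k⁆ = 0 := by
    by_contra hne
    obtain ⟨s, hs⟩ := he.exists_add_of_lie_ne_zero hV hne
    exact h.no_triangle hp hq hs ht
  have hne : ∀ {i j : {i : ι // b.IsPos i}}, i ≠ j → e i ≠ e j := fun hij h' =>
    hij (he.eq_of_eqUpToSign hV (.inl h'))
  have hassoc : ⁅⁅e i, e j⁆, e k⁆ = ⁅e i, ⁅e j, e k⁆⁆ := by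
    rw [lie_lie, h0, lie_zero, sub_zero]
  have htriple : MemUpToSign ⁅⁅e i, e j⁆, e k⁆ (range e) :=
    memUpToSign_of_eqUpToSign (eqUpToSign_trans
      (eqUpToSign_lie (he.lie i j p hp) (eqUpToSign_refl _))
      (he.lie p k t (by rw [ht, hp]))) ⟨t, rfl⟩
  exact
    { mem_left := ⟨i, rfl⟩
      mem_mid := ⟨j, rfl⟩
      mem_right := ⟨k, rfl⟩
      ne_left := hne (he.ne_of_add hV hp)
      ne_right := hne (he.ne_of_add hV hq)
      ne_outer := hne hik
      lie_left := memUpToSign_of_eqUpToSign (he.lie i j p hp) ⟨p, rfl⟩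
      lie_right := memUpToSign_of_eqUpToSign (he.lie j k q hq) ⟨q, rfl⟩
      lie_outer := h0
      assoc := .inl hassoc
      triple_left := htriple
      triple_right := hassoc ▸ htriple
      lie_ne := fun h' => hik <| Subtype.ext <| P.root.injective <| by
        have := he.eq_of_eqUpToSign hV (eqUpToSign_trans
          (eqUpToSign_trans (eqUpToSign_symm (he.lie i j p hp)) h') (he.lie j k q hq))
        rw [this, hq, add_comm (P.root i)] at hp
        exact (add_left_cancel hp).symm }

/-- If `i + j = k + l` is a root and `k - i` is a positive root `d`, then the two decompositions
come from the adjacent triple `i, d, l`. -/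
lemma isSplitBy {d : {i : ι // b.IsPos i}} (hm : P.root m = P.root i + P.root j)
    (hm' : P.root m = P.root k + P.root l) (hd : P.root k = P.root i + P.root d) (hil : i ≠ l) :
    IsSplitBy (range e) (e i) (e j) (e k) (e l) := by
  have hj : P.root j = P.root d + P.root l := by
    rw [hd, hm, add_assoc] at hm'
    exact add_left_cancel hm'
  exact ⟨e i, e d, e l, he.isAdjacent hV h hd hj (by rw [hm', hd]) hil, rfl,
    eqUpToSign_symm (he.lie d l j hj), eqUpToSign_symm (he.lie i d k hd), rfl⟩

end Tame

lemma exists_of_isSplitBy {x y w z : 𝔤} (h : IsSplitBy (range e) x y w z) :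
    ∃ i j k l d m : {i : ι // b.IsPos i}, x = e i ∧ EqUpToSign y (e j) ∧ EqUpToSign w (e k) ∧
      z = e l ∧ P.root k = P.root i + P.root d ∧ P.root j = P.root d + P.root l ∧
      P.root m = P.root k + P.root l ∧ i ≠ l ∧ j ≠ k := by
  obtain ⟨α, β, γ, hadj, rfl, hy, hw, rfl⟩ := h
  obtain ⟨i, rfl⟩ := hadj.mem_left
  obtain ⟨d, rfl⟩ := hadj.mem_mid
  obtain ⟨l, rfl⟩ := hadj.mem_right
  obtain ⟨k, hk, hk'⟩ := he.exists_add_of_memUpToSign hV hadj.lie_left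
  obtain ⟨j, hj, hj'⟩ := he.exists_add_of_memUpToSign hV hadj.lie_right
  obtain ⟨_, ⟨m, rfl⟩, hm⟩ := exists_eqUpToSign_of_memUpToSign hadj.triple_left
  refine ⟨i, j, k, l, d, m, rfl, eqUpToSign_trans hy hj', eqUpToSign_trans hw hk', rfl, hk, hj,
    he.add_of_eqUpToSign hV (eqUpToSign_trans (eqUpToSign_lie (eqUpToSign_symm hk')
      (eqUpToSign_refl _)) hm), ?_, ?_⟩
  · rintro rfl
    exact hadj.ne_outer rfl
  · rintro rfl
    exact hadj.lie_ne (eqUpToSign_trans hk' (eqUpToSign_symm hj'))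

/-- In the tame case the chosen root vectors form a diamond root system, provided that they
generate the ring additively. -/
theorem isDiamondRootSystem [Fintype ι] [P.IsCrystallographic] [P.IsReduced] {ℓ : ι → ℤ} {r : ℤ}
    (h : IsTame P ℓ r) (hspan : Submodule.span ℤ (range e) = ⊤) :
    IsDiamondRootSystem (range e) where
  finite := Set.finite_range e
  linearIndependent := by
    classical
    have h1 := hV.linearIndepOn {i | b.IsPos i} (fun i => if hi : b.IsPos i then e ⟨i, hi⟩ else 0)
      (fun i (hi : b.IsPos i) => by
        rw [dif_pos hi]
        exact ⟨he.mem ⟨i, hi⟩, he.ne_zero ⟨i, hi⟩⟩)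
    have h2 : LinearIndependent ℤ e := by
      convert (show LinearIndependent ℤ (fun i : {i // b.IsPos i} =>
        if hi : b.IsPos i then e ⟨i, hi⟩ else 0) from h1) with i
      rw [dif_pos i.2]
    exact h2.linearIndepOn_id
  span_eq_top := hspan
  neg_notMem := by
    rintro _ ⟨i, rfl⟩ ⟨j, hj⟩
    obtain rfl := he.eq_of_eqUpToSign hV (.inr hj)
    refine hV.zsmul_ne_zero (he.mem j) (he.ne_zero j) two_ne_zero ?_
    rw [two_zsmul]
    exact eq_neg_iff_add_eq_zero.mp hj
  lie_eq_zero_or_mem := by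
    rintro _ ⟨i, rfl⟩ _ ⟨j, rfl⟩ -
    refine or_iff_not_imp_left.mpr fun hne => ?_
    obtain ⟨k, hk⟩ := he.exists_add_of_lie_ne_zero hV hne
    refine memUpToSign_of_eqUpToSign (he.lie i j k hk) ⟨⟨k, rfl⟩, ?_⟩
    rintro (h' | h')
    · obtain rfl := he.eq_of_eqUpToSign hV (.inl h')
      exact P.ne_zero j (left_eq_add.mp hk)
    · obtain rfl := he.eq_of_eqUpToSign hV (.inl h')
      exact P.ne_zero i (right_eq_add.mp hk)
  adjacent := by
    rintro _ ⟨i, rfl⟩ _ ⟨j, rfl⟩ _ ⟨k, rfl⟩ - - hik hij hjk hne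
    obtain ⟨p, hp, hp'⟩ := he.exists_add_of_memUpToSign hV hij
    obtain ⟨q, hq, -⟩ := he.exists_add_of_memUpToSign hV hjk
    obtain ⟨t, ht⟩ := he.exists_add_of_lie_ne_zero hV (i := p) (j := k)
      (ne_zero_of_eqUpToSign (eqUpToSign_lie (eqUpToSign_symm hp') (eqUpToSign_refl (e k))) hne)
    exact he.isAdjacent hV h hp hq (by rw [ht, hp]) fun h' => hik (congrArg e h')
  exists_split := by
    rintro _ ⟨i, rfl⟩ _ ⟨j, rfl⟩ _ ⟨k, rfl⟩ _ ⟨l, rfl⟩ hnodup heq ⟨m, hm⟩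
    simp only [List.nodup_cons, List.mem_cons, List.not_mem_nil, or_false, not_or,
      not_false_eq_true, List.nodup_nil, and_true] at hnodup
    obtain ⟨⟨-, hik, hil⟩, ⟨hjk, hjl⟩, -⟩ := hnodup
    have hne : ∀ {i j : {i : ι // b.IsPos i}}, e i ≠ e j → i ≠ j := fun hij h' =>
      hij (congrArg e h')
    have h1 := he.add_of_eqUpToSign hV (i := i) (j := j) (k := m) (.inl hm.symm)
    have h2 := he.add_of_eqUpToSign hV (i := k) (j := l) (k := m) (.inl (heq ▸ hm.symm))
    have hne' : ∀ {i j : {i : ι // b.IsPos i}}, e i ≠ e j → (i : ι) ≠ j := fun hij h' =>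
      hij (congrArg e (Subtype.ext h'))
    rcases (h.sub_mem_range_or_and_not_and h1 h2 (hne' hik) (hne' hil) (hne' hjk) (hne' hjl)
      (root_ne_neg_root i.2 k.2) (root_ne_neg_root i.2 l.2) (root_ne_neg_root j.2 k.2)
      (root_ne_neg_root j.2 l.2)).1 with hd | hd
    · rcases exists_isPos_of_sub_mem_range (b := b) hd with ⟨d, hdp, hd⟩ | ⟨d, hdp, hd⟩
      · exact ⟨_, _, _, _, Sym2.eq_swap,
          he.isSplitBy hV h (d := ⟨d, hdp⟩) h2 h1 hd (hne hjk).symm⟩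
      · exact ⟨_, _, _, _, rfl, he.isSplitBy hV h (d := ⟨d, hdp⟩) h1 h2 hd (hne hil)⟩
    · rw [add_comm] at h2
      rcases exists_isPos_of_sub_mem_range (b := b) hd with ⟨d, hdp, hd⟩ | ⟨d, hdp, hd⟩
      · refine ⟨e l, e k, e i, e j, ?_,
          he.isSplitBy hV h (d := ⟨d, hdp⟩) h2 h1 hd (hne hjl).symm⟩
        rw [Sym2.eq_swap, Sym2.eq_swap (a := e l)]
      · refine ⟨e i, e j, e l, e k, ?_,
          he.isSplitBy hV h (d := ⟨d, hdp⟩) h1 h2 hd (hne hik)⟩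
        rw [Sym2.eq_swap (a := e l)]
  split_unique := by
    intro _ _ _ _ _ _ _ _ _ _ _ _ _ _ _ _ hsplit
    obtain ⟨i, j, k, l, d, m, rfl, hη, hσ, rfl, hk, hj, hm, hil, hjk⟩ :=
      he.exists_of_isSplitBy hV hsplit
    have hm' : P.root m = P.root i + P.root j := by rw [hm, hk, hj, add_assoc]
    constructor
    · intro hsplit'
      -- Then both differences `i - k` and `i - l` are roots.
      obtain ⟨j', i', k', l', d', -, rfl, hi', hk', hl', hkd, -⟩ :=
        he.exists_of_isSplitBy hV hsplit'
      obtain rfl := he.eq_of_eqUpToSign hV hη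
      obtain rfl := he.eq_of_eqUpToSign hV (eqUpToSign_trans (eqUpToSign_symm hσ) hk')
      have hik : i ≠ k := by
        rintro rfl
        exact P.ne_zero d (left_eq_add.mp hk)
      have hjl : j' ≠ l := by
        rintro rfl
        exact P.ne_zero d (right_eq_add.mp hj)
      have hne : ∀ {i j : {i : ι // b.IsPos i}}, i ≠ j → (i : ι) ≠ j := fun hij h' =>
        hij (Subtype.ext h')
      refine (h.sub_mem_range_or_and_not_and hm' hm (hne hik) (hne hil) (hne hjk) (hne hjl)
        (root_ne_neg_root i.2 k.2) (root_ne_neg_root i.2 l.2) (root_ne_neg_root j'.2 k.2)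
        (root_ne_neg_root j'.2 l.2)).2 ⟨?_, ?_⟩
      · rw [← P.neg_mem_range_root_iff]
        exact ⟨d, by rw [hk]; abel⟩
      · refine ⟨d', ?_⟩
        have := hm.symm.trans hm'
        rw [hkd, add_assoc, add_comm (P.root i)] at this
        exact eq_sub_of_add_eq (add_left_cancel this)
    · intro hsplit'
      -- Then `l - j` is a positive root as well as `j - l`.
      obtain ⟨j', i', l', k', d', -, rfl, -, hl', -, hld, -⟩ := he.exists_of_isSplitBy hV hsplit'
      obtain rfl := he.eq_of_eqUpToSign hV hη
      obtain rfl := he.eq_of_eqUpToSign hV hl'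
      rw [hj, add_assoc, add_left_comm] at hld
      exact root_add_root_ne_zero d.2 d'.2 (left_eq_add.mp hld)

end IsBracketClosed

end Diamond

/-! ### Existence of a bracket closed family of root vectors -/

namespace Diamond

open Set

variable {ι K M N : Type*} [Fintype ι] [Field K] [CharZero K] [AddCommGroup M] [Module K M]
  [AddCommGroup N] [Module K N] {𝔤 : Type*} [LieRing 𝔤] {P : RootPairing ι K M N}
  [P.IsCrystallographic] [P.IsReduced] {V : M → AddSubgroup 𝔤} {b : P.Base}

lemma lie_mem_span {S : Set 𝔤} (hS : ∀ x ∈ S, ∀ y ∈ S, ⁅x, y⁆ ∈ Submodule.span ℤ S) {x y : 𝔤}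
    (hx : x ∈ Submodule.span ℤ S) (hy : y ∈ Submodule.span ℤ S) : ⁅x, y⁆ ∈ Submodule.span ℤ S := by
  induction hx using Submodule.span_induction with
  | mem x hx =>
    induction hy using Submodule.span_induction with
    | mem y hy => exact hS x hx y hy
    | zero => rw [lie_zero]; exact zero_mem _
    | add y z _ _ h1 h2 => rw [lie_add]; exact add_mem h1 h2
    | smul a y _ h1 => rw [lie_zsmul]; exact Submodule.smul_mem _ a h1
  | zero => rw [zero_lie]; exact zero_mem _
  | add x z _ _ h1 h2 => rw [add_lie]; exact add_mem h1 h2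
  | smul a x _ h1 => rw [zsmul_lie]; exact Submodule.smul_mem _ a h1

/-- In the tame case, a ring that is generated by root vectors of the simple roots has a diamond
root system that consists of root vectors. -/
theorem exists_isDiamondRootSystem {ℓ : ι → ℤ} {r : ℤ} (h : IsTame P ℓ r)
    (hV : IsRootGrading P V) (x : b.support → 𝔤) (hx : ∀ i : b.support, x i ∈ V (P.root i))
    (hx0 : ∀ i, x i ≠ 0) (hgen : LieSubalgebra.lieSpan ℤ 𝔤 (range x) = ⊤) :
    ∃ e : {i : ι // b.IsPos i} → 𝔤, (∀ i : {i // b.IsPos i}, e i ∈ V (P.root i)) ∧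
      IsDiamondRootSystem (range e) := by
  choose e he using fun i : {i : ι // b.IsPos i} => exists_isMonomial x i.2
  have hclosed : IsBracketClosed V e :=
    { mem := fun i => (he i).mem hV hx
      ne_zero := fun i => (he i).ne_zero hV hx hx0
      lie := fun i j k hk => (IsMonomial.lie hk (he i) (he j)).eqUpToSign h hV hx (he k) }
  refine ⟨e, hclosed.mem, hclosed.isDiamondRootSystem hV h ?_⟩
  let S : LieSubalgebra ℤ 𝔤 :=
    { Submodule.span ℤ (range e) with
      lie_mem' := lie_mem_span (by
        rintro _ ⟨i, rfl⟩ _ ⟨j, rfl⟩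
        by_cases hij : ⁅e i, e j⁆ = 0
        · rw [hij]
          exact zero_mem _
        · obtain ⟨k, hk⟩ := hclosed.exists_add_of_lie_ne_zero hV hij
          have hk' : e k ∈ Submodule.span ℤ (range e) := Submodule.subset_span ⟨k, rfl⟩
          rcases hclosed.lie i j k hk with h | h
          · rwa [h]
          · rw [h]
            exact neg_mem hk') }
  have hS : S = ⊤ := by
    rw [eq_top_iff, ← hgen, LieSubalgebra.lieSpan_le]
    rintro _ ⟨i, rfl⟩
    have hi : e ⟨i, b.isPos_of_mem_support i.2⟩ ∈ Submodule.span ℤ (range e) :=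
      Submodule.subset_span ⟨_, rfl⟩
    rcases (IsMonomial.simple (x := x) i).eqUpToSign h hV hx (he ⟨i, _⟩) with h | h
    · change x i ∈ Submodule.span ℤ (range e)
      rwa [h]
    · change x i ∈ Submodule.span ℤ (range e)
      rw [h]
      exact neg_mem hi
  exact congrArg LieSubalgebra.toSubmodule hS

/-! ### The exceptional cases -/

/-- The coefficient `2` comes from the two ways in which `c` can be moved past `d`. -/
lemma lie_lie_lie_eq_two_zsmul {a c d : 𝔤} (h : ⁅c, a⁆ = 0) (h' : ⁅d, ⁅d, c⁆⁆ = 0) :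
    ⁅⁅⁅a, d⁆, d⁆, c⁆ = (2 : ℤ) • ⁅⁅⁅a, d⁆, c⁆, d⁆ := by
  have h1 : ⁅a, ⁅d, c⁆⁆ = ⁅⁅a, d⁆, c⁆ := by
    rw [leibniz_lie, ← lie_skew a c, h, neg_zero, lie_zero, add_zero]
  have h2 : ⁅⁅a, d⁆, ⁅d, c⁆⁆ = ⁅⁅⁅a, d⁆, c⁆, d⁆ := by
    rw [lie_lie, h', lie_zero, zero_sub, h1, lie_skew]
  rw [lie_lie ⁅a, d⁆ d c, h2, ← lie_skew d, sub_neg_eq_add, two_zsmul]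

section Exceptional

variable {e : {i : ι // b.IsPos i} → 𝔤} {i j k : ι}

omit [Fintype ι] [P.IsCrystallographic] [P.IsReduced] in
/-- A diamond root system of root vectors is closed under brackets up to sign: the second axiom
leaves no other value for a bracket that does not vanish. -/
lemma eqUpToSign_lie_of_isDiamondRootSystem (hV : IsRootGrading P V)
    (he : ∀ i : {i // b.IsPos i}, e i ∈ V (P.root i))
    (he0 : ∀ i, e i ≠ 0) (hS : IsDiamondRootSystem (range e))
    {i j k : {i // b.IsPos i}} (hk : P.root k = P.root i + P.root j) :
    EqUpToSign ⁅e i, e j⁆ (e k) := by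
  have hne : ⁅e i, e j⁆ ≠ 0 := hV.lie_ne_zero hk (he i) (he j) (he0 i) (he0 j)
  have hij : e i ≠ e j := fun h => hne (by rw [h, lie_self])
  obtain ⟨_, ⟨⟨l, rfl⟩, -⟩, hl⟩ := exists_eqUpToSign_of_memUpToSign
    ((hS.lie_eq_zero_or_mem _ ⟨i, rfl⟩ _ ⟨j, rfl⟩ hij).resolve_left hne)
  have : k = l := Subtype.ext (hV.eq_of_eqUpToSign (hk ▸ hV.lie_mem (he i) (he j)) (he l) hne hl)
  rwa [this]

omit [P.IsReduced] in
/-- The simple roots `i`, `j`, `k` form a part `i ⇒ j - k` of the Dynkin diagram with a double edge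
that points to a simple edge. Then the double bracket with the root vector of `j` produces a
factor `2`. -/
theorem not_isDiamondRootSystem (hV : IsRootGrading P V) (hi : i ∈ b.support) (hj : j ∈ b.support)
    (hk : k ∈ b.support) (hij : P.pairingIn ℤ i j = -2) (hjk : P.pairingIn ℤ j k = -1)
    (hkj : P.pairingIn ℤ k j = -1) (hik : P.pairingIn ℤ i k = 0)
    (he : ∀ i : {i // b.IsPos i}, e i ∈ V (P.root i)) : ¬ IsDiamondRootSystem (range e) := by
  intro hS
  have hreflect : ∀ u v : ι, P.root (P.reflectionPerm v u) =
      P.root u - P.pairingIn ℤ u v • P.root v := fun u v => by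
    rw [P.root_reflectionPerm, P.reflection_apply_root' ℤ]
  have hadd : ∀ {u v w : ι}, P.root w = P.root u + P.root v → ∀ t,
      P.pairingIn ℤ w t = P.pairingIn ℤ u t + P.pairingIn ℤ v t := by
    intro u v w hw t
    apply (algebraMap ℤ K).injective_int
    rw [map_add]
    simp only [P.algebraMap_pairingIn, ← P.root_coroot_eq_pairing, hw, map_add,
      LinearMap.add_apply]
  have he0 : ∀ i, e i ≠ 0 := fun i hi => hS.neg_notMem _ ⟨i, rfl⟩ ⟨i, by rw [hi, neg_zero]⟩
  have hsum : ∀ {u v : ι}, b.IsPos u → b.IsPos v → P.pairingIn ℤ u v < 0 →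
      ∃ w, b.IsPos w ∧ P.root w = P.root u + P.root v := by
    intro u v hu hv huv
    obtain ⟨w, hw⟩ := P.root_add_root_mem_of_pairingIn_neg huv (root_ne_neg_root hu hv)
    exact ⟨w, hu.add hv hw, hw⟩
  have pi := b.isPos_of_mem_support hi
  have pj := b.isPos_of_mem_support hj
  have pk := b.isPos_of_mem_support hk
  obtain ⟨p, pp, hp⟩ := hsum pi pj (by omega)
  obtain ⟨q, hq⟩ : ∃ q, P.root q = P.root p + P.root j :=
    ⟨P.reflectionPerm j i, by rw [hreflect, hij, hp]; module⟩
  have pq := pp.add pj hq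
  obtain ⟨s, ps, hs⟩ := hsum pp pk (by rw [hadd hp]; omega)
  obtain ⟨t, pt, ht⟩ := hsum pq pk (by rw [hadd hq, hadd hp]; omega)
  have hlie : ∀ {u v w : {i // b.IsPos i}} {y z : 𝔤}, P.root w = P.root u + P.root v →
      EqUpToSign y (e u) → EqUpToSign z (e v) → EqUpToSign ⁅y, z⁆ (e w) := fun hw hy hz =>
    eqUpToSign_trans (eqUpToSign_lie hy hz)
      (eqUpToSign_lie_of_isDiamondRootSystem hV he he0 hS hw)
  have h0 : ⁅e ⟨k, pk⟩, e ⟨i, pi⟩⁆ = 0 := by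
    refine hV.lie_eq_zero (root_add_root_ne_zero pk pi) ?_ (he ⟨k, pk⟩) (he ⟨i, pi⟩)
    rintro ⟨u, hu⟩
    refine b.sub_notMem_range_root hi hk ⟨P.reflectionPerm k u, ?_⟩
    rw [hreflect, hadd hu, hik, P.pairingIn_same, hu]
    module
  have h0' : ⁅e ⟨j, pj⟩, ⁅e ⟨j, pj⟩, e ⟨k, pk⟩⁆⁆ = 0 := by
    obtain ⟨u, pu, hu⟩ := hsum pj pk (by omega)
    refine hV.lie_eq_zero (ν := P.root u) (root_add_root_ne_zero pj pu) ?_ (he ⟨j, pj⟩)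
      (hu ▸ hV.lie_mem (he ⟨j, pj⟩) (he ⟨k, pk⟩))
    rintro ⟨v, hv⟩
    refine b.sub_notMem_range_root hk hj ⟨P.reflectionPerm j v, ?_⟩
    rw [hreflect, hadd hv, hadd hu, hkj, P.pairingIn_same, hv, hu]
    module
  have h1 : EqUpToSign ⁅⁅⁅e ⟨i, pi⟩, e ⟨j, pj⟩⁆, e ⟨j, pj⟩⁆, e ⟨k, pk⟩⁆ (e ⟨t, pt⟩) :=
    hlie (u := ⟨q, pq⟩) ht (hlie (u := ⟨p, pp⟩) hq
      (hlie hp (eqUpToSign_refl _) (eqUpToSign_refl _)) (eqUpToSign_refl _)) (eqUpToSign_refl _)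
  have h2 : EqUpToSign ⁅⁅⁅e ⟨i, pi⟩, e ⟨j, pj⟩⁆, e ⟨k, pk⟩⁆, e ⟨j, pj⟩⁆ (e ⟨t, pt⟩) :=
    hlie (u := ⟨s, ps⟩) (by rw [ht, hq, hs]; abel) (hlie (u := ⟨p, pp⟩) hs
      (hlie hp (eqUpToSign_refl _) (eqUpToSign_refl _)) (eqUpToSign_refl _)) (eqUpToSign_refl _)
  rw [lie_lie_lie_eq_two_zsmul h0 h0'] at h1
  have h3 := he0 ⟨t, pt⟩
  have h4 := hV.zsmul_ne_zero (he ⟨t, pt⟩) h3 three_ne_zero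
  generalize e ⟨t, pt⟩ = z at *
  rcases h2 with h2 | h2 <;> rw [h2] at h1 <;> rcases h1 with h1 | h1
  · exact h3 (by linear_combination (norm := module) h1)
  · exact h4 (by linear_combination (norm := module) h1)
  · exact h4 (by linear_combination (norm := module) -h1)
  · exact h3 (by linear_combination (norm := module) -h1)

end Exceptional

end Diamond

/-! ### Root vectors of a semisimple Lie algebra -/

namespace Diamond

open Set Module LieAlgebra LieModule LieAlgebra.IsKilling

variable {K L : Type*} [Field K] [CharZero K] [LieRing L] [LieAlgebra K L] [FiniteDimensional K L]
  [IsKilling K L] {H : LieSubalgebra K L} [H.IsCartanSubalgebra] [IsTriangularizable K H L]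

lemma exists_smul_eq_of_mem_rootSpace {α : Weight K H L} (hα : α.IsNonZero) {x y : L}
    (hx : x ∈ rootSpace H α) (hy : y ∈ rootSpace H α) (hx0 : x ≠ 0) : ∃ c : K, c • x = y := by
  simpa using (finrank_eq_one_iff_of_nonzero' (⟨x, hx⟩ : rootSpace H α) (by simpa using hx0)).mp
    (finrank_rootSpace_eq_one α hα) ⟨y, hy⟩

/-- The bracket of two root vectors does not vanish if the sum of the roots is a root. -/
theorem lie_ne_zero_of_mem_rootSpace {α β : Weight K H L} (hα : α.IsNonZero) (hβ : β.IsNonZero)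
    (h : rootSpace H (α + β : H → K) ≠ ⊥) {x y : L} (hx : x ∈ rootSpace H α)
    (hy : y ∈ rootSpace H β) (hx0 : x ≠ 0) (hy0 : y ≠ 0) : ⁅x, y⁆ ≠ 0 := by
  obtain ⟨h', e, f, ht, he, hf⟩ := exists_isSl2Triple_of_weight_isNonZero hα
  obtain rfl := ht.h_eq_coroot hα he hf
  obtain ⟨z, hz, hz0⟩ := (chainTop α β).exists_ne_zero
  have prim : ht.HasPrimitiveVectorWith z (chainLength α β : K) :=
    have := lie_mem_genWeightSpace_of_mem_genWeightSpace he hz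
    ⟨hz0, (chainLength_smul _ _ hz).symm, by rwa [genWeightSpace_add_chainTop _ _ hα] at this⟩
  have h1 : (1 : ℤ) ≤ chainTopCoeff α β :=
    ((rootSpace_zsmul_add_ne_bot_iff α β hα 1).mp (by rwa [one_smul])).1
  obtain ⟨s, hs⟩ : ∃ s, chainTopCoeff α β = s + 1 := ⟨chainTopCoeff α β - 1, by omega⟩
  have hsn := chainTopCoeff_le_chainLength α β
  -- The root space of `β` lies `s + 1` steps below the top of the `α`-chain through `β`.
  have hw := toEnd_pow_apply_mem hf hz (s + 1)
  have hβ' : (s + 1) • (-α : H → K) + chainTop α β = β := by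
    rw [coe_chainTop', hs, smul_neg, neg_add_cancel_left]
  rw [hβ'] at hw
  have hw0 := prim.pow_toEnd_f_ne_zero_of_eq_nat rfl (i := s + 1) (by omega)
  obtain ⟨c, rfl⟩ := exists_smul_eq_of_mem_rootSpace hα he hx ht.e_ne_zero
  obtain ⟨d, rfl⟩ := exists_smul_eq_of_mem_rootSpace hβ hw hy hw0
  rw [smul_lie, lie_smul, prim.lie_e_pow_succ_toEnd_f]
  refine smul_ne_zero (left_ne_zero_of_smul hx0) (smul_ne_zero (left_ne_zero_of_smul hy0)
    (smul_ne_zero (mul_ne_zero ?_ ?_) (prim.pow_toEnd_f_ne_zero_of_eq_nat rfl (by omega))))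
  · exact_mod_cast s.succ_ne_zero
  · rw [sub_ne_zero]
    exact_mod_cast (show chainLength α β ≠ s by omega)

omit [CharZero K] in
lemma nonempty_of_isRootSystem {ι M N : Type*} [AddCommGroup M] [Module K M] [AddCommGroup N]
    [Module K N] (P : RootPairing ι K M N) [P.IsRootSystem] [P.IsIrreducible] : Nonempty ι := by
  have := RootPairing.IsIrreducible.nontrivial P
  by_contra! hι
  have h := RootPairing.IsRootSystem.span_root_eq_top (P := P)
  rw [range_eq_empty, Submodule.span_empty] at h
  exact bot_ne_top h

/-- The elements of a Lie subring that lie in the root space of a linear form. -/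
def rootSubgroup (H : LieSubalgebra K L) [H.IsCartanSubalgebra] (G : LieSubalgebra ℤ L)
    (μ : Dual K H) : AddSubgroup G :=
  (rootSpace H μ).toSubmodule.toAddSubgroup.comap G.toSubmodule.toAddSubgroup.subtype

theorem isRootGrading_rootSubgroup (G : LieSubalgebra ℤ L) :
    IsRootGrading (rootSystem H) (rootSubgroup H G) where
  lie_mem hx hy := lie_mem_genWeightSpace_of_mem_genWeightSpace hx hy
  eq_zero {μ x} hμ hμ' hx := by
    by_contra hx0
    refine hμ' ?_
    have hbot : rootSpace H μ ≠ ⊥ := fun h => hx0 <| Subtype.ext <| by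
      have : (x : L) ∈ rootSpace H μ := hx
      rwa [h] at this
    let α : Weight K H L := ⟨μ, hbot⟩
    have hα : α ∈ H.root := by
      simp only [LieSubalgebra.root, Finset.mem_filter, Finset.mem_univ, true_and]
      intro h
      exact hμ (LinearMap.ext fun t => congrFun h t)
    exact ⟨⟨α, hα⟩, LinearMap.ext fun t => rfl⟩
  lie_ne_zero {i j k x y} hk hx hy hx0 hy0 h := by
    have hnz : ∀ i : H.root, i.1.IsNonZero := fun i =>
      (Finset.mem_filter.mp i.2).2
    have hk' : (k.1 : H → K) = i.1 + j.1 := funext fun t => LinearMap.congr_fun hk t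
    exact lie_ne_zero_of_mem_rootSpace (hnz i) (hnz j) (hk' ▸ k.1.genWeightSpace_ne_bot) hx hy
      (fun h => hx0 (Subtype.ext h)) (fun h => hy0 (Subtype.ext h)) (congrArg Subtype.val h)
  linearIndepOn s e he := by
    have h1 : iSupIndep fun χ : s => (rootSpace H (χ : H.root).1).toSubmodule := by
      have := (iSupIndep_genWeightSpace' K H L)
      rw [← LieSubmodule.iSupIndep_toSubmodule] at this
      exact this.comp (f := fun χ : s => (χ : H.root).1)
        (Subtype.val_injective.comp Subtype.val_injective)
    have h2 : LinearIndependent K (fun i : s => (e i : L)) :=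
      h1.linearIndependent _ (fun i => (he i i.2).1) (fun i => by simpa using (he i i.2).2)
    have h3 := h2.restrict_scalars' ℤ
    exact LinearIndependent.of_comp G.toSubmodule.subtype h3

lemma lieSpan_range_eq_top {ι : Type*} (x : ι → L) :
    LieSubalgebra.lieSpan ℤ (integralLieSpan x)
      (range fun i => (⟨x i, LieSubalgebra.subset_lieSpan ⟨i, rfl⟩⟩ : integralLieSpan x)) = ⊤ := by
  rw [eq_top_iff]
  rintro ⟨y, hy⟩ -
  induction hy using LieSubalgebra.lieSpan_induction with
  | mem y hy =>
    obtain ⟨i, rfl⟩ := hy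
    exact LieSubalgebra.subset_lieSpan ⟨i, rfl⟩
  | zero => exact zero_mem _
  | add y z _ _ h1 h2 => exact add_mem h1 h2
  | smul a y _ h1 => exact LieSubalgebra.smul_mem _ a h1
  | lie y z _ _ h1 h2 => exact LieSubalgebra.lie_mem _ h1 h2

end Diamond

theorem theorem2p2 {L : Type*} [LieRing L] [LieAlgebra ℂ L] [FiniteDimensional ℂ L]
    [LieAlgebra.IsSimple ℂ L] (H : LieSubalgebra ℂ L) [H.IsCartanSubalgebra]
    (b : (LieAlgebra.IsKilling.rootSystem H).Base)
    (x : b.support → L)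
    (hx : ∀ i : b.support, x i ∈ LieAlgebra.rootSpace H (i : H.root).1 ∧ x i ≠ 0) :
    (∃ e : {α : H.root // b.IsPos α} → integralLieSpan x,
      (∀ α : {α : H.root // b.IsPos α}, (e α : L) ∈ LieAlgebra.rootSpace H α.1.1) ∧
      IsDiamondRootSystem (Set.range e)) ↔
    ¬ ((∃ n : ℕ, 2 < n ∧ SameDynkinGraph b.cartanMatrix (CartanMatrix.C n)) ∨
      SameDynkinGraph b.cartanMatrix CartanMatrix.F₄) := by
  have hV := Diamond.isRootGrading_rootSubgroup (H := H) (integralLieSpan x)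
  constructor
  · rintro ⟨e, he, hS⟩ (⟨n, hn, f, hf⟩ | ⟨f, hf⟩)
    · -- The long simple root of `Cₙ` is the last one.
      have hA : ∀ i j : Fin n, b.cartanMatrix (f.symm i) (f.symm j) = CartanMatrix.C n i j :=
        fun i j => by rw [hf, f.apply_symm_apply, f.apply_symm_apply]
      refine Diamond.not_isDiamondRootSystem hV (f.symm ⟨n - 1, by omega⟩).2
        (f.symm ⟨n - 2, by omega⟩).2 (f.symm ⟨n - 3, by omega⟩).2 ((hA _ _).trans ?_)
        ((hA _ _).trans ?_) ((hA _ _).trans ?_) ((hA _ _).trans ?_) he hS <;>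
      · simp only [CartanMatrix.C, Matrix.of_apply, Fin.mk.injEq]
        split_ifs <;> omega
    · have hA : ∀ i j : Fin 4, b.cartanMatrix (f.symm i) (f.symm j) = CartanMatrix.F₄ i j :=
        fun i j => by rw [hf, f.apply_symm_apply, f.apply_symm_apply]
      exact Diamond.not_isDiamondRootSystem hV (f.symm 1).2 (f.symm 2).2 (f.symm 3).2 (hA 1 2)
        (hA 2 3) (hA 3 2) (hA 1 3) he hS
  · intro hb
    have : Nonempty H.root := Diamond.nonempty_of_isRootSystem (LieAlgebra.IsKilling.rootSystem H)
    obtain ⟨ℓ, r, h⟩ := Diamond.exists_isNormalizedLength (P := LieAlgebra.IsKilling.rootSystem H)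
    exact Diamond.exists_isDiamondRootSystem (h.isTame_of_not_sameDynkinGraph b hb) hV _
      (fun i => (hx i).1) (fun i h0 => (hx i).2 (congrArg Subtype.val h0))
      (Diamond.lieSpan_range_eq_top x)
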